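/- **Setting.** There are $N$ agents acting in the order $1,\dots,N$. The state space $\mathsf X$ and the observation spaces $\mathsf Y_1,\dots,\mathsf Y_N$ are Borel spaces (standard Borel), the action spaces $\mathsf U_1,\dots,\mathsf U_N$ are finite and nonempty, $\mathbb P$ is a probability measure on $\mathsf X$, $W_i(dy_i\mid x,u_1,\dots,u_{i-1})$ is a stochastic kernel on $\mathsf Y_i$ (the observation channel of agent $i$), and $p:\mathsf X\times\prod_i\mathsf Y_i\times\prod_i\mathsf U_i\to[0,\infty)$ is a measurable reward. Let $\Delta_i\subset\mathbb R^{\mathsf U_i}$ be the simplex of probability distributions on $\mathsf U_i$, with the $\ell_1$ norm. A policy is a tuple $\gamma=(\gamma_1,\dots,\gamma_N)\in\Gamma=\prod_i\Gamma_i$ of measurable functions $\gamma_i:\mathsf Y_i\to\Delta_i$. **(AC)** For each $i$ there is a probability measure $\pi_i$ on $\mathsf Y_i$ such that $W_i(\cdot\mid x,u_1,\dots,u_{i-1})$ is absolutely continuous with respect to $\pi_i$ for all $(x,u_1,\dots,u_{i-1})$, with a (jointly measurable) density $f_i(y_i,x,u_1,\dots,u_{i-1})$. Put $$r(y,u)=\int_{\mathsf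 X}p(x,y,u)\prod_{i=1}^N f_i(y_i,x,u_1,\dots,u_{i-1})\,\mathbb P(dx),\qquad R(y,\delta)=\sum_u r(y,u)\prod_{i=1}^N\delta_i(u_i).$$ It is assumed that $r$ is real-valued and that every policy has finite expected reward $J(\gamma)=E[p(X,Y,U)]=\int\sum_u p(x,y,u)\prod_i\gamma_i(u_i\mid y_i)\,W_i(dy_i\mid x,u_1,\dots,u_{i-1})\,\mathbb P(dx)$. For each $i$ let $\Omega_i:\Delta_i\to\mathbb R$ be lower semicontinuous and $\rho_i$-strongly convex with respect to the $\ell_1$ norm, $\rho_i>0$. Let $$R^{\mathrm{reg}}(y,\delta)=R(y,\delta)-\sum_{i=1}^N\Omega_i(\delta_i),\qquad J^{\mathrm{reg}}(\gamma)=\int R^{\mathrm{reg}}(y,\gamma(y))\prod_{i=1}^N\pi_i(dy_i).$$ A policy is an optimal regularized team decision rule if it attains $\sup_{\gamma\in\Gamma}J^{\mathrm{reg}}(\gamma)$. The best response operator is $\mathsf B(\gamma)=(\mathsf B_1(\gamma^{-1}),\dots,\mathsf B_N(\gamma^{-N}))$, where $\gamma^{-j}=(\gamma_i)_{i\ne j}$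 and $$\mathsf B_j(\gamma^{-j})(y_j)=\operatorname*{arg\,max}_{\delta_j\in\Delta_j}\ \int R\bigl(y,\gamma^{-j}(y^{-j}),\delta_j\bigr)\prod_{i\ne j}\pi_i(dy_i)-\Omega_j(\delta_j)$$ (on the $\pi_j$-null set of those $y_j$ for which the integral diverges, it is read as $0$). Let $\|\gamma_i\|_{L_1}=\int\|\gamma_i(y_i)\|_1\,\pi_i(dy_i)$ and $\|\gamma\|=(\|\gamma_1\|_{L_1},\dots,\|\gamma_N\|_{L_1})$. Let $\lambda_j(r)=\sup_{y,u^{-j}}\bigl[\sup_{u_j}r(y,u)-\inf_{u_j}r(y,u)\bigr]$, and let $P$ be the $N\times N$ matrix with $P(j,i)=\lambda_i(r)/(2\rho_j)$ for $i\ne j$ and $P(j,j)=0$. **Theorem.** Suppose that (AC) holds, that the entries of $P$ are finite and that the spectral radius of $P$ is strictly less than $1$. Then $J^{\mathrm{reg}}(\gamma)$ is a convergent integral for every policy $\gamma$, the set of maximizers defining $\mathsf B_j(\gamma^{-j})(y_j)$ is always a singleton, and $\mathsf B$ maps $\Gamma$ to $\Gamma$. The operator $\mathsf B$ has a unique fixed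 point $\gamma^*\in\Gamma$. For every $\gamma^0\in\Gamma$ the iterates $\gamma^{k+1}=\mathsf B(\gamma^k)$ satisfy $\lim_{k\to\infty}\|\gamma^k-\gamma^*\|=0$. Moreover, $\gamma^*$ is the optimal regularized team decision rule: it is optimal, and every optimal $\xi\in\Gamma$ has $\xi_i=\gamma^*_i$ $\pi_i$-almost everywhere for all $i$. Consider further the asynchronous algorithm. At each time $t=1,2,\dots$ each agent either computes, or transmits to some of the agents, or is idle. Agent $j$ stores in its memory a tuple $\gamma^{(t)}(j)=(\gamma^{(t)}_1(j),\dots,\gamma^{(t)}_N(j))$, where $\gamma^{(0)}(j)\in\Gamma$ is arbitrary. If agent $i$ computes at time $t$, then $\gamma^{(t)}_i(i)=\mathsf B_i\bigl((\gamma^{(t-1)}_k(i))_{k\ne i}\bigr)$; if agent $i$ transmits to agent $j\neq i$ at time $t$, then $\gamma^{(t)}_i(j)=\gamma^{(t-1)}_i(i)$; all other memory entries are unchanged. Suppose that for each agent $j$ and time $t$ there is $t'>t$ such that between $t$ and $t'$ agent $j$ computes at least once and transmits at least once to every other agent. Then, with $\gamma^{(t)}=(\gamma^{(t)}_1(1),\dots,\gamma^{(t)}_N(N))$,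 $$\lim_{t\to\infty}\|\gamma^{(t)}-\gamma^*\|=0.$$ -/

import Mathlib

open MeasureTheory ProbabilityTheory Filter Topology
open scoped ENNReal NNReal

noncomputable section

namespace RegTeam

/-- `ℝ^A` with the `ℓ¹` norm, for a finite set `A` of actions. -/
abbrev ActVec (A : Type*) : Type _ := PiLp 1 (fun _ : A => ℝ)

/-- The set of probability distributions on the finite set `A`, inside `ℝ^A`. -/
def simplex (A : Type*) [Fintype A] : Set (ActVec A) :=
  {d | (∀ a, 0 ≤ d a) ∧ ∑ a, d a = 1}

/-- The actions of the agents preceding agent `i`. -/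
abbrev Past {N : ℕ} (U : Fin N → Type*) (i : Fin N) : Type _ := (k : {k : Fin N // k < i}) → U k

/-- The actions of the agents preceding `i`, extracted from the actions of all agents. -/
def past {N : ℕ} {U : Fin N → Type*} (u : (i : Fin N) → U i) (i : Fin N) : Past U i :=
  fun k => u k

/-- Witsenhausen's intrinsic model: `N` agents acting in the order `0, 1, …, N - 1`, a state with
law `prior`, observation channels `Y_i ∼ W_i(· | x, u_0, …, u_{i-1})`, and a nonnegative reward. -/
structure Team (N : ℕ) (X : Type*) (Y U : Fin N → Type*) [MeasurableSpace X]
    [∀ i, MeasurableSpace (Y i)] where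
  /-- the law of the state -/
  prior : Measure X
  prior_prob : IsProbabilityMeasure prior
  /-- the observation channels -/
  channel : (i : Fin N) → Past U i → Kernel X (Y i)
  channel_markov : ∀ i v, IsMarkovKernel (channel i v)
  /-- the reward function -/
  reward : X → ((i : Fin N) → Y i) → ((i : Fin N) → U i) → ℝ≥0
  reward_meas : ∀ u, Measurable fun q : X × ((i : Fin N) → Y i) => reward q.1 q.2 u

/-- Absolute continuity of the observation channels: probability measures `π_i` on the
observation spaces and jointly measurable densities
`f_i(·, x, u_0, …, u_{i-1}) = dW_i(· | x, u_0, …, u_{i-1}) / dπ_i`. -/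
structure AbsCont {N : ℕ} {X : Type*} {Y U : Fin N → Type*} [MeasurableSpace X]
    [∀ i, MeasurableSpace (Y i)] (T : Team N X Y U) where
  /-- the reference measures -/
  ref : (i : Fin N) → Measure (Y i)
  ref_prob : ∀ i, IsProbabilityMeasure (ref i)
  /-- the densities -/
  density : (i : Fin N) → Past U i → X → Y i → ℝ≥0
  density_meas : ∀ i v, Measurable fun q : X × Y i => density i v q.1 q.2
  channel_eq : ∀ i v x,
    T.channel i v x = (ref i).withDensity (fun y => (density i v x y : ℝ≥0∞))

section Policies

variable {N : ℕ} {Y U : Fin N → Type*}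

/-- Tuples `(γ_1, …, γ_N)` of functions `γ_i : Y_i → ℝ^{U_i}`. -/
abbrev Profile (Y U : Fin N → Type*) : Type _ := (i : Fin N) → Y i → ActVec (U i)

/-- The set `Γ`: each `γ_i` is a measurable function from `Y_i` to the simplex on `U_i`. -/
def IsPolicy [∀ i, MeasurableSpace (Y i)] [∀ i, Fintype (U i)] (g : Profile Y U) : Prop :=
  ∀ i, Measurable (g i) ∧ ∀ y, g i y ∈ simplex (U i)

/-- The vector of `L¹(π_i)` norms of a tuple. -/
def normVec [∀ i, MeasurableSpace (Y i)] [∀ i, Fintype (U i)] (ref : (i : Fin N) → Measure (Y i))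
    (g : Profile Y U) : Fin N → ℝ :=
  fun i => ∫ y, ‖g i y‖ ∂(ref i)

end Policies

section Model

variable {N : ℕ} {X : Type*} {Y U : Fin N → Type*} [MeasurableSpace X]
  [∀ i, MeasurableSpace (Y i)] [∀ i, Fintype (U i)]

/-- The expected reward `J(γ) = E[p(X, 𝐘, 𝐔)]` in the original dynamic team, where
`Y_i ∼ W_i(· | X, U_0, …, U_{i-1})` and `U_i ∼ γ_i(· | Y_i)`. -/
def expReward (T : Team N X Y U) (g : Profile Y U) : ℝ≥0∞ :=
  ∫⁻ x, ∑ u : ((i : Fin N) → U i), ∫⁻ y, (T.reward x y u : ℝ≥0∞) *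
      ∏ i, ENNReal.ofReal (g i (y i) (u i))
    ∂(Measure.pi fun i => T.channel i (past u i) x) ∂T.prior

/-- `r(y, u) = ∫ p(x, y, u) ∏ f_i(y_i, x, u_0, …, u_{i-1}) P(dx)`, with values in `[0, ∞]`. -/
def redRewardENN {T : Team N X Y U} (A : AbsCont T) (y : (i : Fin N) → Y i)
    (u : (i : Fin N) → U i) : ℝ≥0∞ :=
  ∫⁻ x, (T.reward x y u : ℝ≥0∞) * ∏ i, (A.density i (past u i) x (y i) : ℝ≥0∞) ∂T.prior

/-- The reward `r(y, u)` of the independent static reduction, as a real number. -/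
def redReward {T : Team N X Y U} (A : AbsCont T) (y : (i : Fin N) → Y i)
    (u : (i : Fin N) → U i) : ℝ :=
  (redRewardENN A y u).toReal

/-- `R(y, δ) = ∑_u r(y, u) ∏_i δ_i(u_i)`. -/
def mixReward {T : Team N X Y U} (A : AbsCont T) (y : (i : Fin N) → Y i)
    (d : (i : Fin N) → ActVec (U i)) : ℝ :=
  ∑ u : ((i : Fin N) → U i), redReward A y u * ∏ i, d i (u i)

/-- `R^reg(y, δ) = R(y, δ) - ∑_i Ω_i(δ_i)`. -/
def regReward {T : Team N X Y U} (A : AbsCont T) (Om : (i : Fin N) → ActVec (U i) → ℝ)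
    (y : (i : Fin N) → Y i) (d : (i : Fin N) → ActVec (U i)) : ℝ :=
  mixReward A y d - ∑ i, Om i (d i)

/-- `J^reg(γ) = ∫ R^reg(y, γ(y)) ∏ π_i(dy_i)`. -/
def regJ {T : Team N X Y U} (A : AbsCont T) (Om : (i : Fin N) → ActVec (U i) → ℝ)
    (g : Profile Y U) : ℝ :=
  ∫ y, regReward A Om y (fun i => g i (y i)) ∂(Measure.pi A.ref)

/-- Optimal regularized team decision rules: policies attaining the supremum of `J^reg`. -/
def IsOptimal {T : Team N X Y U} (A : AbsCont T) (Om : (i : Fin N) → ActVec (U i) → ℝ)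
    (g : Profile Y U) : Prop :=
  IsPolicy g ∧ ∀ h : Profile Y U, IsPolicy h → regJ A Om h ≤ regJ A Om g

/-- The objective of agent `j` at the observation `yj`, against the policies `γ_i`, `i ≠ j`:
`∫ R(y, γ^{-j}(y^{-j}), δ) ∏_{i ≠ j} π_i(dy_i) - Ω_j(δ)`. The integrand does not depend on the
`j`-th coordinate of the integration variable, and `π_j` is a probability measure, so that the
integral over `∏_i π_i` is the one over `∏_{i ≠ j} π_i`. -/
def brObjective {T : Team N X Y U} (A : AbsCont T) (Om : (i : Fin N) → ActVec (U i) → ℝ)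
    (g : Profile Y U) (j : Fin N) (yj : Y j) (d : ActVec (U j)) : ℝ :=
  (∫ y, mixReward A (Function.update y j yj) (Function.update (fun i => g i (y i)) j d)
    ∂(Measure.pi A.ref)) - Om j d

/-- A maximizer of `F` over `s` (an arbitrary vector if there is none). -/
def argmaxOn {E : Type*} [Nonempty E] (F : E → ℝ) (s : Set E) : E :=
  Classical.epsilon fun d => d ∈ s ∧ IsMaxOn F s d

/-- The best response operator `B(γ) = (B_1(γ^{-1}), …, B_N(γ^{-N}))`. -/
def bestResp {T : Team N X Y U} (A : AbsCont T) (Om : (i : Fin N) → ActVec (U i) → ℝ)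
    (g : Profile Y U) : Profile Y U :=
  fun j yj => argmaxOn (brObjective A Om g j yj) (simplex (U j))

/-- The local oscillation
`λ_j(r) = sup_{y, u^{-j}} [sup_{u_j} r(y, u) - inf_{u_j} r(y, u)]`, with values in `[0, ∞]`. -/
def localOsc {T : Team N X Y U} (A : AbsCont T) (j : Fin N) : ℝ≥0∞ :=
  ⨆ (y : (i : Fin N) → Y i) (u : (i : Fin N) → U i),
    ENNReal.ofReal ((⨆ a : U j, redReward A y (Function.update u j a)) -
      (⨅ a : U j, redReward A y (Function.update u j a)))

/-- The matrix `P` with `P(j, i) = λ_i(r) / (2 ρ_j)` for `i ≠ j` and `P(j, j) = 0`. -/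
def gainMatrix {T : Team N X Y U} (A : AbsCont T) (rho : Fin N → ℝ) :
    Matrix (Fin N) (Fin N) ℝ :=
  Matrix.of fun j i => if i = j then 0 else 1 / rho j * ((localOsc A i).toReal / 2)

/-- The entries of `P` are finite, and its spectral radius is less than `1`. -/
def SmallGain {T : Team N X Y U} (A : AbsCont T) (rho : Fin N → ℝ) : Prop :=
  (∀ i j : Fin N, i ≠ j → localOsc A i ≠ ∞) ∧
    spectralRadius ℂ ((gainMatrix A rho).map Complex.ofReal) < 1

end Model

section Async

/-- What an agent does at one iteration time. -/
inductive Activity (N : ℕ) : Type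
  | compute : Activity N
  | transmit (recipients : Set (Fin N)) : Activity N
  | idle : Activity N

variable {N : ℕ}

/-- Agent `i` computes at time `t`. -/
def Computes (s : ℕ → Fin N → Activity N) (t : ℕ) (i : Fin N) : Prop :=
  s t i = Activity.compute

/-- Agent `i` transmits to agent `j` at time `t`. -/
def Transmits (s : ℕ → Fin N → Activity N) (t : ℕ) (i j : Fin N) : Prop :=
  ∃ S : Set (Fin N), s t i = Activity.transmit S ∧ j ∈ S

/-- For each agent `j` and each time `t` there is `t' > t` such that between `t` and `t'` agent `j`
computes at least once and transmits to every other agent. -/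
def FairSchedule (s : ℕ → Fin N → Activity N) : Prop :=
  ∀ (j : Fin N) (t : ℕ), ∃ t' : ℕ, t < t' ∧
    (∃ q : ℕ, t < q ∧ q ≤ t' ∧ Computes s q j) ∧
    ∀ i : Fin N, i ≠ j → ∃ q : ℕ, t < q ∧ q ≤ t' ∧ Transmits s q j i

open Classical in
/-- `mem t j` is the memory of agent `j` at time `t`. A computation of `i` at time `t + 1` replaces
its own policy by its best response to the others stored in its memory at time `t`; a transmission
from `i` to `j ≠ i` at time `t + 1` copies the own policy of `i` at time `t` into the memory of `j`;
nothing else changes. The initial memories are arbitrary policies. -/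
def IsAsyncRun {Y U : Fin N → Type*} [∀ i, MeasurableSpace (Y i)] [∀ i, Fintype (U i)]
    (B : Profile Y U → Profile Y U) (s : ℕ → Fin N → Activity N)
    (mem : ℕ → Fin N → Profile Y U) : Prop :=
  (∀ j, IsPolicy (mem 0 j)) ∧
  ∀ t : ℕ,
    (∀ i, mem (t + 1) i i = if Computes s (t + 1) i then B (mem t i) i else mem t i i) ∧
    ∀ i j, i ≠ j → mem (t + 1) j i = if Transmits s (t + 1) i j then mem t i i else mem t j i

end Async

end RegTeam

end

/-!
# Best response dynamics for regularized teams

The reduced reward `r` turns the dynamic team into a static one with independent observations.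
In that team, the objective of agent `j` at an observation `y_j` is a linear functional of its
distribution minus a `ρ_j`-strongly convex function, so the best response is the maximizer of a
regularized linear program over the simplex (`regArgmax`). By quadratic growth
(`regLin_add_sq_le`) the maximizer is unique and `1 / ρ_j`-Lipschitz in the coefficients
(`norm_regArgmax_sub_le`). The coefficients change by at most `λ_i(r) / 2 * D_i` when the policy of
agent `i` moves by at most `D_i` at all observations (`abs_mixSlice_sub_le`). Hence the best
response operator maps a vector `D` of uniform distances to at most `P D`
(`RegularTeam.norm_bestResp_sub_le`). Nothing is lost by working with uniform distances: they
dominate the `L¹` distances, and any two policies are at uniform distance at most `2`.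

Since `P` is nonnegative of spectral radius less than `1`, there are weights `v ≥ 1` and `θ < 1`
with `P v ≤ θ v` (`exists_weights`), so that the operator contracts a weighted sup norm by `θ`. This
gives the fixed point and the convergence of the synchronous iterates. In the asynchronous
algorithm, every memory entry gains a factor `θ` once all agents have computed and then transmitted
(`RegularTeam.eventually_mem_step`).

For optimality, replacing the policy of one agent by its best response increases `J^reg` by at least
`ρ_j / 2` times the mean square displacement (`RegularTeam.regJ_update_add_le`). Starting from any
policy, sweeps of such replacements converge uniformly to the fixed point by the contraction
property, and `J^reg` at the limit is at least the limit of the values: the mixed rewards converge by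
dominated convergence, and the regularizers are controlled by the optimality of the fixed point
against single deviations (`RegularTeam.regJ_le_of_fixed`). An optimal rule coincides almost
everywhere with its best response. The best response depends only on the almost everywhere class of
the policies, so it is itself a fixed point, hence the unique one.

Integrals that diverge at exceptional observations `y_j` are read as `0`. With two or more agents,
all oscillations `λ_i(r)` are finite, so the set of these observations does not depend on the
policies or on the action of agent `j`; with a single agent it is empty
(`integrable_mixSlice_of`).
-/

noncomputable section

namespace RegTeam

/-! ### The simplex with the `ℓ¹` norm -/

section Simplex

variable {α : Type*} [Fintype α]

lemma simplex_eq_image : simplex α = WithLp.toLp 1 '' stdSimplex ℝ α := by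
  ext d
  constructor
  · intro h
    exact ⟨d.ofLp, h, rfl⟩
  · rintro ⟨f, hf, rfl⟩
    exact hf

lemma isCompact_simplex : IsCompact (simplex α) := by
  rw [simplex_eq_image]
  exact (isCompact_stdSimplex ℝ α).image (PiLp.continuous_toLp 1 _)

lemma convex_simplex : Convex ℝ (simplex α) := by
  intro d hd e he a b ha hb hab
  refine ⟨fun i => ?_, ?_⟩
  · have h1 := mul_nonneg ha (hd.1 i)
    have h2 := mul_nonneg hb (he.1 i)
    simpa using add_nonneg h1 h2
  · simp [Finset.sum_add_distrib, ← Finset.mul_sum, hd.2, he.2, hab]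

lemma single_mem_simplex [DecidableEq α] (a : α) : PiLp.single 1 a (1 : ℝ) ∈ simplex α := by
  refine ⟨fun b => ?_, ?_⟩
  · by_cases h : b = a
    · subst h; simp
    · rw [PiLp.single_eq_of_ne 1 h]
  · rw [Finset.sum_eq_single a] <;> simp +contextual [PiLp.single_eq_of_ne]

lemma simplex_nonempty [Nonempty α] : (simplex α).Nonempty := by
  classical
  exact ⟨_, single_mem_simplex (Classical.arbitrary α)⟩

lemma le_one_of_mem_simplex {d : ActVec α} (hd : d ∈ simplex α) (a : α) : d a ≤ 1 := by
  rw [← hd.2]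
  exact Finset.single_le_sum (f := fun a => d a) (fun b _ => hd.1 b) (Finset.mem_univ a)

lemma norm_of_mem_simplex {d : ActVec α} (hd : d ∈ simplex α) : ‖d‖ = 1 := by
  rw [PiLp.norm_eq_of_L1, ← hd.2]
  exact Finset.sum_congr rfl fun a _ => abs_of_nonneg (hd.1 a)

lemma norm_sub_le_two {d e : ActVec α} (hd : d ∈ simplex α) (he : e ∈ simplex α) :
    ‖d - e‖ ≤ 2 := by
  have := norm_sub_le d e
  rw [norm_of_mem_simplex hd, norm_of_mem_simplex he] at this
  linarith

lemma abs_sum_mul_le_of_abs_le {c : α → ℝ} {M : ℝ} (hc : ∀ a, |c a| ≤ M) (z : ActVec α) :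
    |∑ a, z a * c a| ≤ M * ‖z‖ := by
  rw [PiLp.norm_eq_of_L1, Finset.mul_sum]
  refine (Finset.abs_sum_le_sum_abs _ _).trans (Finset.sum_le_sum fun a _ => ?_)
  rw [abs_mul, mul_comm, Real.norm_eq_abs]
  exact mul_le_mul_of_nonneg_right (hc a) (abs_nonneg _)

/-- The half of the oscillation suffices because `d - e` has total mass `0`, so that the midpoint
of the range of `m` may be subtracted from `m`. -/
lemma abs_sum_sub_mul_le [Nonempty α] {m : α → ℝ} {L : ℝ} (hm : ∀ a b, m a - m b ≤ L)
    {d e : ActVec α} (hd : d ∈ simplex α) (he : e ∈ simplex α) :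
    |∑ a, d a * m a - ∑ a, e a * m a| ≤ L / 2 * ‖d - e‖ := by
  obtain ⟨p, hp⟩ := Finite.exists_max m
  obtain ⟨q, hq⟩ := Finite.exists_min m
  have key : ∑ a, d a * m a - ∑ a, e a * m a
      = ∑ a, (d - e) a * (m a - (m p + m q) / 2) := by
    simp only [PiLp.sub_apply, mul_sub, sub_mul, Finset.sum_sub_distrib, ← Finset.sum_mul,
      hd.2, he.2]
    ring
  rw [key]
  refine abs_sum_mul_le_of_abs_le (fun a => ?_) _
  rw [abs_le]
  constructor <;> linarith [hp a, hq a, hm p q]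

end Simplex

/-! ### Regularized linear programs over the simplex -/

lemma argmaxOn_congr {E : Type*} [Nonempty E] {F G : E → ℝ} {s : Set E} (h : Set.EqOn F G s) :
    argmaxOn F s = argmaxOn G s := by
  unfold argmaxOn
  congr 1
  funext d
  simp only [IsMaxOn, IsMaxFilter, eventually_principal, eq_iff_iff]
  refine and_congr_right fun hd => forall₂_congr fun x hx => ?_
  rw [h hd, h hx]

section RegLin

variable {α : Type*} [Fintype α]

/-- The regularized linear functional `d ↦ ⟨d, c⟩ - ω(d)`. -/
def regLin (om : ActVec α → ℝ) (c : α → ℝ) (d : ActVec α) : ℝ := ∑ a, d a * c a - om d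

/-- The maximizer of `d ↦ ⟨d, c⟩ - ω(d)` over the simplex. -/
def regArgmax (om : ActVec α → ℝ) (c : α → ℝ) : ActVec α := argmaxOn (regLin om c) (simplex α)

variable {om : ActVec α → ℝ} {ρ : ℝ}

lemma exists_isMaxOn_regLin [Nonempty α] (hlsc : LowerSemicontinuousOn om (simplex α))
    (c : α → ℝ) : ∃ d ∈ simplex α, IsMaxOn (regLin om c) (simplex α) d := by
  refine UpperSemicontinuousOn.exists_isMaxOn simplex_nonempty isCompact_simplex ?_
  have h1 : Continuous fun d : ActVec α => ∑ a, d a * c a := by fun_prop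
  intro d hd y hy
  simp only [regLin] at hy
  obtain ⟨ε, hε, hε'⟩ : ∃ ε > 0, (∑ a, d a * c a - om d) + 2 * ε < y :=
    ⟨(y - (∑ a, d a * c a - om d)) / 4, by linarith, by linarith⟩
  have h2 := hlsc d hd (om d - ε) (by linarith)
  have h3 : ∀ᶠ x in 𝓝[simplex α] d, ∑ a, x a * c a < ∑ a, d a * c a + ε :=
    mem_nhdsWithin_of_mem_nhds ((h1.tendsto d).eventually_lt_const (by linarith))
  filter_upwards [h2, h3] with x hx2 hx3
  simp only [regLin]
  linarith

lemma regArgmax_spec [Nonempty α] (hlsc : LowerSemicontinuousOn om (simplex α)) (c : α → ℝ) :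
    regArgmax om c ∈ simplex α ∧ IsMaxOn (regLin om c) (simplex α) (regArgmax om c) :=
  Classical.epsilon_spec (exists_isMaxOn_regLin hlsc c)

/-- Quadratic growth away from a maximizer. -/
lemma regLin_add_sq_le (hom : StrongConvexOn (simplex α) ρ om) {c : α → ℝ} {d x : ActVec α}
    (hd : d ∈ simplex α) (hmax : IsMaxOn (regLin om c) (simplex α) d) (hx : x ∈ simplex α)
    (hρ : 0 ≤ ρ) :
    regLin om c x + ρ / 2 * ‖x - d‖ ^ 2 ≤ regLin om c d := by
  have key : ∀ t : ℝ, 0 < t → t < 1 →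
      regLin om c x + (1 - t) * (ρ / 2 * ‖x - d‖ ^ 2) ≤ regLin om c d := by
    intro t ht ht1
    have h1 := hom.2 hx hd ht.le (sub_nonneg.2 ht1.le) (by ring)
    have h2 : regLin om c (t • x + (1 - t) • d) ≤ regLin om c d :=
      hmax (convex_simplex hx hd ht.le (sub_nonneg.2 ht1.le) (by ring))
    simp only [regLin, smul_eq_mul] at h1 h2 ⊢
    have h3 : ∑ a, (t • x + (1 - t) • d) a * c a
        = t * ∑ a, x a * c a + (1 - t) * ∑ a, d a * c a := by
      simp only [PiLp.add_apply, PiLp.smul_apply, smul_eq_mul, Finset.mul_sum,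
        ← Finset.sum_add_distrib]
      exact Finset.sum_congr rfl fun a _ => by ring
    rw [h3] at h2
    refine le_of_mul_le_mul_left ?_ ht
    linarith
  by_contra! hlt
  set q := ρ / 2 * ‖x - d‖ ^ 2
  have hq : 0 ≤ q := by positivity
  set gap := regLin om c x + q - regLin om c d with hgap
  have hg : 0 < gap := by linarith
  -- `t` is small enough for `t * q < gap`
  have ht : gap / (2 * (q + gap)) * (2 * (q + gap)) = gap := by field_simp
  have ht0 : 0 < gap / (2 * (q + gap)) := by positivity
  have ht1 : gap / (2 * (q + gap)) < 1 := by
    rw [div_lt_one (by positivity)]; linarith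
  have := key _ ht0 ht1
  have := mul_pos ht0 hg
  linarith

lemma isMaxOn_regLin_iff [Nonempty α] (hom : StrongConvexOn (simplex α) ρ om) (hρ : 0 < ρ)
    (hlsc : LowerSemicontinuousOn om (simplex α)) {c : α → ℝ} {d : ActVec α}
    (hd : d ∈ simplex α) :
    IsMaxOn (regLin om c) (simplex α) d ↔ d = regArgmax om c := by
  obtain ⟨h1, h2⟩ := regArgmax_spec hlsc c
  constructor
  · intro hmax
    have h3 := regLin_add_sq_le hom h1 h2 hd hρ.le
    have h4 : regLin om c (regArgmax om c) ≤ regLin om c d := hmax h1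
    have h5 : ‖d - regArgmax om c‖ ^ 2 ≤ 0 := by
      have : 0 < ρ / 2 := by positivity
      by_contra! h
      have := mul_pos this h
      linarith
    have h6 : ‖d - regArgmax om c‖ = 0 := by
      have := sq_nonneg ‖d - regArgmax om c‖
      exact pow_eq_zero_iff two_ne_zero |>.1 (le_antisymm h5 this)
    exact sub_eq_zero.1 (norm_eq_zero.1 h6)
  · rintro rfl
    exact h2

/-- The maximizer is `1 / ρ`-Lipschitz from the sup norm to the `ℓ¹` norm. -/
lemma norm_regArgmax_sub_le [Nonempty α] (hom : StrongConvexOn (simplex α) ρ om) (hρ : 0 < ρ)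
    (hlsc : LowerSemicontinuousOn om (simplex α)) {c c' : α → ℝ} {M : ℝ}
    (hM : ∀ a, |c a - c' a| ≤ M) :
    ‖regArgmax om c - regArgmax om c'‖ ≤ 1 / ρ * M := by
  obtain ⟨h1, h2⟩ := regArgmax_spec hlsc c
  obtain ⟨h1', h2'⟩ := regArgmax_spec hlsc c'
  set d := regArgmax om c
  set d' := regArgmax om c'
  have e1 := regLin_add_sq_le hom h1 h2 h1' hρ.le
  have e2 := regLin_add_sq_le hom h1' h2' h1 hρ.le
  rw [norm_sub_rev d' d] at e1
  have e3 := (le_abs_self _).trans (abs_sum_mul_le_of_abs_le hM (d - d'))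
  have e4 : ∑ a, (d - d') a * (c a - c' a) = (∑ a, d a * c a - ∑ a, d' a * c a)
      - (∑ a, d a * c' a - ∑ a, d' a * c' a) := by
    simp only [← Finset.sum_sub_distrib, PiLp.sub_apply]
    exact Finset.sum_congr rfl fun a _ => by ring
  simp only [regLin] at e1 e2
  have e5 : ρ * ‖d - d'‖ ^ 2 ≤ M * ‖d - d'‖ := by linarith
  have hM0 : 0 ≤ M := (abs_nonneg _).trans (hM (Classical.arbitrary α))
  rcases (norm_nonneg (d - d')).eq_or_lt with h | h
  · rw [← h]; positivity
  · rw [one_div, ← div_eq_inv_mul, le_div_iff₀ hρ]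
    refine le_of_mul_le_mul_right ?_ h
    linarith [e5]

lemma continuous_regArgmax [Nonempty α] (hom : StrongConvexOn (simplex α) ρ om) (hρ : 0 < ρ)
    (hlsc : LowerSemicontinuousOn om (simplex α)) : Continuous (regArgmax om) := by
  have : LipschitzWith (Real.toNNReal (1 / ρ)) (regArgmax om) := by
    refine LipschitzWith.of_dist_le_mul fun c c' => ?_
    rw [dist_eq_norm, Real.coe_toNNReal _ (by positivity)]
    exact norm_regArgmax_sub_le hom hρ hlsc fun a => by
      rw [← Real.dist_eq]; exact dist_le_pi_dist c c' a
  exact this.continuous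

/-- A convex lower semicontinuous function is bounded on the simplex: by its values at the vertices
from above, and by compactness from below. -/
lemma exists_abs_le_of_strongConvexOn [Nonempty α] (hom : StrongConvexOn (simplex α) ρ om)
    (hρ : 0 < ρ) (hlsc : LowerSemicontinuousOn om (simplex α)) :
    ∃ C, ∀ d ∈ simplex α, |om d| ≤ C := by
  classical
  obtain ⟨d₀, -, hd₀⟩ := hlsc.exists_isMinOn simplex_nonempty isCompact_simplex
  obtain ⟨p, hp⟩ := Finite.exists_max fun a : α => om (PiLp.single 1 a 1)
  have hconv : ConvexOn ℝ (simplex α) om := (hom.strictConvexOn hρ).convexOn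
  refine ⟨|om d₀| + |om (PiLp.single 1 p 1)|, fun d hd => ?_⟩
  have h1 : om d₀ ≤ om d := hd₀ hd
  have h2 : om d ≤ om (PiLp.single 1 p 1) := by
    have h3 := hconv.map_sum_le (t := Finset.univ) (w := fun a => d a)
      (p := fun a => PiLp.single 1 a (1 : ℝ)) (fun a _ => hd.1 a) hd.2
      (fun a _ => single_mem_simplex a)
    have h4 : ∑ a, d a • PiLp.single 1 a (1 : ℝ) = d := by
      ext b
      rw [WithLp.ofLp_sum, Finset.sum_apply, Finset.sum_eq_single b]
      · simp
      · intro a _ hab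
        simp [hab.symm]
      · simp
    rw [h4] at h3
    refine h3.trans ?_
    calc ∑ a, d a • om (PiLp.single 1 a 1) ≤ ∑ a, d a * om (PiLp.single 1 p 1) :=
          Finset.sum_le_sum fun a _ => mul_le_mul_of_nonneg_left (hp a) (hd.1 a)
      _ = om (PiLp.single 1 p 1) := by rw [← Finset.sum_mul, hd.2, one_mul]
  have h5 := neg_abs_le (om d₀)
  have h6 := le_abs_self (om (PiLp.single 1 p 1))
  rw [abs_le]
  constructor <;> linarith [abs_nonneg (om d₀), abs_nonneg (om (PiLp.single 1 p 1))]

lemma measurable_comp_of_lowerSemicontinuousOn {β : Type*} [MeasurableSpace β] {f : β → ActVec α}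
    (hf : Measurable f) (hmem : ∀ y, f y ∈ simplex α)
    (hlsc : LowerSemicontinuousOn om (simplex α)) : Measurable fun y => om (f y) := by
  have h1 : LowerSemicontinuous ((simplex α).domRestrict om) :=
    lowerSemicontinuous_restrict_iff.2 hlsc
  exact h1.measurable.comp (hf.subtype_mk (h := hmem))

end RegLin

/-! ### A weighted sup norm contracted by a nonnegative matrix of small spectral radius -/

section Weights

variable {ι : Type*} [Fintype ι] [DecidableEq ι]

/-- By Gelfand's formula, some power of a matrix of spectral radius less than `1` has small
rows. -/
lemma exists_pow_row_sum_le_half {P : Matrix ι ι ℝ}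
    (hP : spectralRadius ℂ (P.map Complex.ofReal) < 1) :
    ∃ m : ℕ, 1 ≤ m ∧ ∀ j, ∑ i, |(P ^ m) j i| ≤ 1 / 2 := by
  let _ : NormedRing (Matrix ι ι ℂ) := Matrix.linftyOpNormedRing
  let _ : NormedAlgebra ℂ (Matrix ι ι ℂ) := Matrix.linftyOpNormedAlgebra
  have : CompleteSpace (Matrix ι ι ℂ) := FiniteDimensional.complete ℂ _
  obtain ⟨q, hq, hq1⟩ := ENNReal.lt_iff_exists_nnreal_btwn.1 hP
  have hq1' : q < 1 := by exact_mod_cast hq1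
  have h1 := (spectrum.pow_nnnorm_pow_one_div_tendsto_nhds_spectralRadius
    (P.map Complex.ofReal)).eventually_lt_const hq
  have h2 : ∀ᶠ n : ℕ in atTop, q ^ n < 1 / 2 :=
    (tendsto_pow_atTop_nhds_zero_of_lt_one zero_le hq1').eventually_lt_const (by norm_num)
  obtain ⟨m, ⟨hm1, hm2⟩, hm⟩ := ((h1.and h2).and (eventually_ge_atTop 1)).exists
  refine ⟨m, hm, fun j => ?_⟩
  have h3 : ‖(P.map Complex.ofReal) ^ m‖₊ < q ^ m := by
    have hm0 : (0 : ℝ) < m := by exact_mod_cast hm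
    have h4 := ENNReal.rpow_lt_rpow hm1 hm0
    rw [← ENNReal.rpow_mul, one_div, inv_mul_cancel₀ hm0.ne', ENNReal.rpow_one,
      ENNReal.rpow_natCast] at h4
    exact_mod_cast h4
  have h5 : (P.map Complex.ofReal) ^ m = (P ^ m).map Complex.ofReal :=
    (map_pow Complex.ofRealHom.mapMatrix P m).symm
  rw [h5] at h3
  have h6 : ∑ i, ‖((P ^ m).map Complex.ofReal) j i‖₊ ≤ ‖(P ^ m).map Complex.ofReal‖₊ := by
    rw [Matrix.linfty_opNNNorm_def]
    exact Finset.le_sup (f := fun j => ∑ i, ‖((P ^ m).map Complex.ofReal) j i‖₊)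
      (Finset.mem_univ j)
  have h7 := h6.trans (h3.trans hm2).le
  have h8 : ((∑ i, ‖((P ^ m).map Complex.ofReal) j i‖₊ : ℝ≥0) : ℝ) ≤ ((1 / 2 : ℝ≥0) : ℝ) := h7
  simpa using h8

/-- The truncated Neumann series `v = ∑_{k < m} P ^ k 1` satisfies `P v ≤ v - 1 + P ^ m 1`. -/
lemma exists_weights {P : Matrix ι ι ℝ} (hnn : ∀ j i, 0 ≤ P j i)
    (hP : spectralRadius ℂ (P.map Complex.ofReal) < 1) :
    ∃ (v : ι → ℝ) (θ : ℝ), (∀ i, 1 ≤ v i) ∧ 0 ≤ θ ∧ θ < 1 ∧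
      ∀ j, ∑ i, P j i * v i ≤ θ * v j := by
  obtain ⟨m, hm, hrow⟩ := exists_pow_row_sum_le_half hP
  have hnnp : ∀ (k : ℕ) j i, 0 ≤ (P ^ k) j i := by
    intro k
    induction k with
    | zero =>
      intro j i
      rw [pow_zero, Matrix.one_apply]
      split_ifs <;> norm_num
    | succ k ih =>
      intro j i
      rw [pow_succ, Matrix.mul_apply]
      exact Finset.sum_nonneg fun l _ => mul_nonneg (ih j l) (hnn l i)
  set w : ℕ → ι → ℝ := fun k j => ∑ i, (P ^ k) j i with hw
  have hw0 : ∀ k j, 0 ≤ w k j := fun k j => Finset.sum_nonneg fun i _ => hnnp k j i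
  have hw_zero : ∀ j, w 0 j = 1 := by
    intro j
    simp [hw, Matrix.one_apply]
  have hw_succ : ∀ k j, ∑ i, P j i * w k i = w (k + 1) j := by
    intro k j
    simp only [hw, pow_succ', Matrix.mul_apply, Finset.mul_sum]
    exact Finset.sum_comm
  have hwm : ∀ j, w m j ≤ 1 / 2 := fun j =>
    (Finset.sum_le_sum fun i _ => le_abs_self _).trans (hrow j)
  set v : ι → ℝ := fun j => ∑ k ∈ Finset.range m, w k j with hv
  have hv1 : ∀ j, 1 ≤ v j := by
    intro j
    rw [← hw_zero j]
    exact Finset.single_le_sum (f := fun k => w k j) (fun k _ => hw0 k j)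
      (Finset.mem_range.2 hm)
  have hPv : ∀ j, ∑ i, P j i * v i = v j - 1 + w m j := by
    intro j
    have h1 : ∑ i, P j i * v i = ∑ k ∈ Finset.range m, w (k + 1) j := by
      simp only [hv, Finset.mul_sum, ← hw_succ]
      exact Finset.sum_comm
    have h2 := Finset.sum_range_succ (fun k => w k j) m
    have h3 := Finset.sum_range_succ' (fun k => w k j) m
    rw [hw_zero] at h3
    rw [h1]
    simp only [hv]
    linarith
  set V : ℝ := 1 + ∑ j, v j with hV
  have hvsum : ∀ j, v j ≤ ∑ j, v j := fun j =>
    Finset.single_le_sum (f := v) (fun i _ => zero_le_one.trans (hv1 i)) (Finset.mem_univ j)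
  have hV1 : 1 ≤ V := by
    have : 0 ≤ ∑ j, v j := Finset.sum_nonneg fun i _ => zero_le_one.trans (hv1 i)
    linarith
  have hVinv : 1 / (2 * V) ≤ 1 / 2 := one_div_le_one_div_of_le (by norm_num) (by linarith)
  have hVpos : 0 < 1 / (2 * V) := by positivity
  refine ⟨v, 1 - 1 / (2 * V), hv1, by linarith, by linarith, fun j => ?_⟩
  rw [hPv]
  have h1 : 1 / (2 * V) * v j ≤ 1 / 2 := by
    rw [one_div_mul_eq_div, div_le_iff₀ (by positivity)]
    linarith [hvsum j]
  linarith [hwm j]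

end Weights

/-! ### Product measures -/

section PiMeasure

lemma measurable_update_uncurry {ι : Type*} [DecidableEq ι] {Y : ι → Type*}
    [∀ i, MeasurableSpace (Y i)] (j : ι) :
    Measurable fun q : Y j × ((i : ι) → Y i) => Function.update q.2 j q.1 :=
  measurable_update'.comp measurable_swap

variable {ι : Type*} [Fintype ι] {Y : ι → Type*} [∀ i, MeasurableSpace (Y i)]
  {μ : (i : ι) → Measure (Y i)} [∀ i, IsProbabilityMeasure (μ i)]

lemma lintegral_pi_prod {f : (i : ι) → Y i → ℝ≥0∞} (hf : ∀ i, Measurable (f i)) :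
    ∫⁻ y, ∏ i, f i (y i) ∂(Measure.pi μ) = ∏ i, ∫⁻ x, f i x ∂(μ i) := by
  refine (lintegral_prod_eq_prod_lintegral_of_indepFun Finset.univ
    (fun i (y : (i : ι) → Y i) => f i (y i))
    (iIndepFun_pi fun i => (hf i).aemeasurable)
    fun i => (hf i).comp (measurable_pi_apply i)).trans ?_
  exact Finset.prod_congr rfl fun i _ => (measurePreserving_eval μ i).lintegral_comp (hf i)

lemma pi_withDensity {f : (i : ι) → Y i → ℝ≥0∞} (hf : ∀ i, Measurable (f i))
    [∀ i, SigmaFinite ((μ i).withDensity (f i))] :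
    Measure.pi (fun i => (μ i).withDensity (f i))
      = (Measure.pi μ).withDensity fun y => ∏ i, f i (y i) := by
  refine Measure.pi_eq fun s hs => ?_
  rw [withDensity_apply _ (MeasurableSet.univ_pi hs),
    ← lintegral_indicator (MeasurableSet.univ_pi hs)]
  have h1 : ((Set.univ.pi s).indicator fun y => ∏ i, f i (y i))
      = fun y => ∏ i, (s i).indicator (f i) (y i) := by
    funext y
    by_cases hy : y ∈ Set.univ.pi s
    · rw [Set.indicator_of_mem hy]
      exact Finset.prod_congr rfl fun i _ =>
        (Set.indicator_of_mem (hy i (Set.mem_univ i)) _).symm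
    · rw [Set.indicator_of_notMem hy]
      obtain ⟨i, hi⟩ : ∃ i, y i ∉ s i := by simpa using hy
      exact (Finset.prod_eq_zero (Finset.mem_univ i) (Set.indicator_of_notMem hi _)).symm
  rw [h1, lintegral_pi_prod fun i => (hf i).indicator (hs i)]
  exact Finset.prod_congr rfl fun i _ => by
    rw [lintegral_indicator (hs i), withDensity_apply _ (hs i)]

variable [DecidableEq ι]

/-- Resampling one coordinate of a product measure. -/
lemma measurePreserving_update (j : ι) :
    MeasurePreserving (fun q : Y j × ((i : ι) → Y i) => Function.update q.2 j q.1)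
      ((μ j).prod (Measure.pi μ)) (Measure.pi μ) := by
  refine ⟨measurable_update_uncurry j, (Measure.pi_eq fun s hs => ?_).symm⟩
  rw [Measure.map_apply (measurable_update_uncurry j) (MeasurableSet.univ_pi hs)]
  have h1 : (fun q : Y j × ((i : ι) → Y i) => Function.update q.2 j q.1) ⁻¹' Set.univ.pi s
      = s j ×ˢ Set.univ.pi (Function.update s j Set.univ) := by
    ext ⟨a, y⟩
    simp only [Set.mem_preimage, Set.mem_pi, Set.mem_univ, true_implies, Set.mem_prod]
    constructor
    · intro h
      refine ⟨by simpa using h j, fun i => ?_⟩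
      by_cases hi : i = j
      · subst hi; simp
      · simpa [Function.update_of_ne hi] using h i
    · rintro ⟨h, h'⟩ i
      by_cases hi : i = j
      · subst hi; simpa using h
      · simpa [Function.update_of_ne hi] using h' i
  rw [h1, Measure.prod_prod, Measure.pi_pi, ← Finset.mul_prod_erase _ _ (Finset.mem_univ j),
    ← Finset.mul_prod_erase _ (fun i => μ i (s i)) (Finset.mem_univ j)]
  simp only [Function.update_self, measure_univ, one_mul]
  congr 1
  exact Finset.prod_congr rfl fun i hi => by
    rw [Function.update_of_ne (Finset.ne_of_mem_erase hi)]

end PiMeasure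

/-! ### The reduced reward -/

section Reward

lemma sum_prod_eq_one {N : ℕ} {U : Fin N → Type*} [∀ i, Fintype (U i)]
    {d : (i : Fin N) → ActVec (U i)} (hd : ∀ i, d i ∈ simplex (U i)) :
    ∑ u : ((i : Fin N) → U i), ∏ i, d i (u i) = 1 := by
  classical
  have h := Finset.prod_univ_sum (fun i => (Finset.univ : Finset (U i))) fun i a => d i a
  rw [Fintype.piFinset_univ] at h
  rw [← h]
  exact Finset.prod_eq_one fun i _ => (hd i).2

variable {N : ℕ} {X : Type*} {Y U : Fin N → Type*} [MeasurableSpace X]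
  [∀ i, MeasurableSpace (Y i)]

instance (T : Team N X Y U) : IsProbabilityMeasure T.prior := T.prior_prob

instance (T : Team N X Y U) (i : Fin N) (v : Past U i) : IsMarkovKernel (T.channel i v) :=
  T.channel_markov i v

variable {T : Team N X Y U}

instance (A : AbsCont T) (i : Fin N) : IsProbabilityMeasure (A.ref i) := A.ref_prob i

variable (A : AbsCont T)

lemma measurable_density_prod (u : (i : Fin N) → U i) :
    Measurable fun q : X × ((i : Fin N) → Y i) =>
      ∏ i, (A.density i (past u i) q.1 (q.2 i) : ℝ≥0∞) :=
  Finset.measurable_prod _ fun i _ => ((A.density_meas i (past u i)).comp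
    (measurable_fst.prodMk ((measurable_pi_apply i).comp measurable_snd))).coe_nnreal_ennreal

lemma measurable_reward_mul_density (u : (i : Fin N) → U i) :
    Measurable fun q : X × ((i : Fin N) → Y i) =>
      (T.reward q.1 q.2 u : ℝ≥0∞) * ∏ i, (A.density i (past u i) q.1 (q.2 i) : ℝ≥0∞) :=
  (T.reward_meas u).coe_nnreal_ennreal.mul (measurable_density_prod A u)

lemma measurable_redReward (u : (i : Fin N) → U i) : Measurable fun y => redReward A y u :=
  (measurable_reward_mul_density A u).lintegral_prod_left'.ennreal_toReal

lemma redReward_nonneg (y : (i : Fin N) → Y i) (u : (i : Fin N) → U i) : 0 ≤ redReward A y u :=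
  ENNReal.toReal_nonneg

/-- The conditional law of the observations given the state, under the open-loop actions `u`. -/
lemma pi_channel_eq (u : (i : Fin N) → U i) (x : X) :
    Measure.pi (fun i => T.channel i (past u i) x) = (Measure.pi A.ref).withDensity
      fun y => ∏ i, (A.density i (past u i) x (y i) : ℝ≥0∞) := by
  have h1 : (fun i => T.channel i (past u i) x)
      = fun i => (A.ref i).withDensity fun y => (A.density i (past u i) x y : ℝ≥0∞) :=
    funext fun i => A.channel_eq i (past u i) x
  have h2 : ∀ i, SigmaFinite ((A.ref i).withDensity
      fun y => (A.density i (past u i) x y : ℝ≥0∞)) := fun i => by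
    rw [← A.channel_eq]; infer_instance
  rw [h1, pi_withDensity]
  exact fun i => ((A.density_meas i (past u i)).comp measurable_prodMk_left).coe_nnreal_ennreal

variable [∀ i, Fintype (U i)]

/-- The expected reward of the open-loop policy that always plays `u` is at least
`∫ r(y, u) ∏ π_i(dy_i)`. -/
lemma lintegral_redRewardENN_ne_top
    (hJ : ∀ g : Profile Y U, IsPolicy g → expReward T g ≠ ∞) (u : (i : Fin N) → U i) :
    ∫⁻ y, redRewardENN A y u ∂(Measure.pi A.ref) ≠ ∞ := by
  classical
  have hpol : IsPolicy (fun i (_ : Y i) => (PiLp.single 1 (u i) (1 : ℝ) : ActVec (U i))) :=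
    fun i => ⟨measurable_const, fun _ => single_mem_simplex (u i)⟩
  refine ne_top_of_le_ne_top (hJ _ hpol) ?_
  calc ∫⁻ y, redRewardENN A y u ∂(Measure.pi A.ref)
      = ∫⁻ x, ∫⁻ y, (T.reward x y u : ℝ≥0∞) *
          ∏ i, (A.density i (past u i) x (y i) : ℝ≥0∞) ∂(Measure.pi A.ref) ∂T.prior := by
        unfold redRewardENN
        exact lintegral_lintegral_swap (f := fun y x => (T.reward x y u : ℝ≥0∞) *
          ∏ i, (A.density i (past u i) x (y i) : ℝ≥0∞))
          ((measurable_reward_mul_density A u).comp measurable_swap).aemeasurable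
    _ ≤ expReward T _ := by
        refine lintegral_mono fun x => ?_
        refine le_trans (le_of_eq ?_) (Finset.single_le_sum
          (f := fun u' : (i : Fin N) → U i => ∫⁻ y, (T.reward x y u' : ℝ≥0∞) *
            ∏ i, ENNReal.ofReal ((PiLp.single 1 (u i) (1 : ℝ) : ActVec (U i)) (u' i))
            ∂(Measure.pi fun i => T.channel i (past u' i) x))
          (fun _ _ => zero_le) (Finset.mem_univ u))
        simp only [PiLp.single_eq_same, ENNReal.ofReal_one, Finset.prod_const_one, mul_one]
        rw [pi_channel_eq A]
        refine Eq.trans (lintegral_congr fun y => mul_comm _ _)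
          (lintegral_withDensity_eq_lintegral_mul _
            (f := fun y => ∏ i, (A.density i (past u i) x (y i) : ℝ≥0∞))
            (g := fun y => (T.reward x y u : ℝ≥0∞))
            ((measurable_density_prod A u).comp measurable_prodMk_left)
            ((T.reward_meas u).comp measurable_prodMk_left).coe_nnreal_ennreal).symm

lemma integrable_redReward (hJ : ∀ g : Profile Y U, IsPolicy g → expReward T g ≠ ∞)
    (u : (i : Fin N) → U i) :
    Integrable (fun y => redReward A y u) (Measure.pi A.ref) :=
  integrable_toReal_of_lintegral_ne_top
    (measurable_reward_mul_density A u).lintegral_prod_left'.aemeasurable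
    (lintegral_redRewardENN_ne_top A hJ u)

lemma redReward_update_sub_le {j : Fin N} (hj : localOsc A j ≠ ∞) (y : (i : Fin N) → Y i)
    (u : (i : Fin N) → U i) (a b : U j) :
    redReward A y (Function.update u j a) - redReward A y (Function.update u j b)
      ≤ (localOsc A j).toReal := by
  rw [← ENNReal.ofReal_le_iff_le_toReal hj]
  refine le_trans (ENNReal.ofReal_le_ofReal ?_) (le_iSup₂_of_le y u le_rfl)
  exact sub_le_sub
    (le_ciSup (f := fun a : U j => redReward A y (Function.update u j a))
      (Set.finite_range _).bddAbove a)
    (ciInf_le (f := fun a : U j => redReward A y (Function.update u j a))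
      (Set.finite_range _).bddBelow b)

/-! ### Mixed rewards as functions of a single agent's distribution -/

/-- The mixed reward when agent `j` plays `a` and the other agents mix according to `d`. The
factor `d_j(u_j)` only contributes the total mass `1`. -/
def mixSlice (j : Fin N) (y : (i : Fin N) → Y i) (d : (i : Fin N) → ActVec (U i)) (a : U j) : ℝ :=
  ∑ u : ((i : Fin N) → U i), redReward A y (Function.update u j a) * ∏ i, d i (u i)

/-- Averaging over `u_j` and an independent `a` is symmetric in the two, because
`(u, a) ↦ (update u j a, u_j)` is an involution. -/
lemma mixReward_update (j : Fin N) (y : (i : Fin N) → Y i) {d : (i : Fin N) → ActVec (U i)}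
    (hd : d j ∈ simplex (U j)) (e : ActVec (U j)) :
    mixReward A y (Function.update d j e) = ∑ a, e a * mixSlice A j y d a := by
  let H : (((i : Fin N) → U i) × U j) → ℝ := fun p =>
    redReward A y p.1 * (e (p.1 j) * ∏ i ∈ Finset.univ.erase j, d i (p.1 i)) * d j p.2
  let φ : (((i : Fin N) → U i) × U j) → (((i : Fin N) → U i) × U j) := fun p =>
    (Function.update p.1 j p.2, p.1 j)
  have hφ : Function.Involutive φ := fun p => by simp [φ]
  have h1 : ∑ p, H p = ∑ p, H (φ p) := (Equiv.sum_comp hφ.toPerm H).symm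
  have h2 : ∑ p, H p = mixReward A y (Function.update d j e) := by
    rw [Fintype.sum_prod_type]
    refine Finset.sum_congr rfl fun u _ => ?_
    simp only [H, ← Finset.mul_sum, hd.2, mul_one]
    rw [← Finset.mul_prod_erase _ (fun i => Function.update d j e i (u i)) (Finset.mem_univ j),
      Function.update_self]
    congr 2
    exact Finset.prod_congr rfl fun i hi => by
      rw [Function.update_of_ne (Finset.ne_of_mem_erase hi)]
  have h3 : ∑ p, H (φ p) = ∑ a, e a * mixSlice A j y d a := by
    rw [Fintype.sum_prod_type_right]
    refine Finset.sum_congr rfl fun a _ => ?_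
    rw [mixSlice, Finset.mul_sum]
    refine Finset.sum_congr rfl fun u _ => ?_
    have h4 : ∏ i ∈ Finset.univ.erase j, d i (Function.update u j a i)
        = ∏ i ∈ Finset.univ.erase j, d i (u i) :=
      Finset.prod_congr rfl fun i hi => by
        rw [Function.update_of_ne (Finset.ne_of_mem_erase hi)]
    simp only [H, φ, Function.update_self, h4]
    rw [← Finset.mul_prod_erase _ (fun i => d i (u i)) (Finset.mem_univ j)]
    ring
  rw [← h2, h1, h3]

lemma mixSlice_eq_mixReward (j : Fin N) [DecidableEq (U j)] (y : (i : Fin N) → Y i)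
    {d : (i : Fin N) → ActVec (U i)} (hd : d j ∈ simplex (U j)) (a : U j) :
    mixSlice A j y d a = mixReward A y (Function.update d j (PiLp.single 1 a 1)) := by
  rw [mixReward_update A j y hd, Finset.sum_eq_single a]
  · simp
  · intro b _ hb
    simp [hb]
  · simp

lemma mixSlice_nonneg (j : Fin N) (y : (i : Fin N) → Y i) {d : (i : Fin N) → ActVec (U i)}
    (hd : ∀ i, d i ∈ simplex (U i)) (a : U j) : 0 ≤ mixSlice A j y d a :=
  Finset.sum_nonneg fun _ _ => mul_nonneg (redReward_nonneg A _ _)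
    (Finset.prod_nonneg fun i _ => (hd i).1 _)

lemma mixSlice_sub_le {j : Fin N} (hj : localOsc A j ≠ ∞) (y : (i : Fin N) → Y i)
    {d : (i : Fin N) → ActVec (U i)} (hd : ∀ i, d i ∈ simplex (U i)) (a b : U j) :
    mixSlice A j y d a - mixSlice A j y d b ≤ (localOsc A j).toReal := by
  calc mixSlice A j y d a - mixSlice A j y d b
      = ∑ u : ((i : Fin N) → U i), (redReward A y (Function.update u j a)
          - redReward A y (Function.update u j b)) * ∏ i, d i (u i) := by
        rw [mixSlice, mixSlice, ← Finset.sum_sub_distrib]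
        exact Finset.sum_congr rfl fun u _ => (sub_mul _ _ _).symm
    _ ≤ ∑ u : ((i : Fin N) → U i), (localOsc A j).toReal * ∏ i, d i (u i) :=
        Finset.sum_le_sum fun u _ => mul_le_mul_of_nonneg_right
          (redReward_update_sub_le A hj y u a b) (Finset.prod_nonneg fun i _ => (hd i).1 _)
    _ = (localOsc A j).toReal := by rw [← Finset.mul_sum, sum_prod_eq_one hd, mul_one]

lemma abs_mixReward_update_sub_le [∀ i, Nonempty (U i)] {j : Fin N} (y : (i : Fin N) → Y i)
    {d : (i : Fin N) → ActVec (U i)} (hd : ∀ i, d i ∈ simplex (U i)) {e e' : ActVec (U j)}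
    (he : e ∈ simplex (U j)) (he' : e' ∈ simplex (U j)) (hj : e ≠ e' → localOsc A j ≠ ∞) :
    |mixReward A y (Function.update d j e) - mixReward A y (Function.update d j e')|
      ≤ (localOsc A j).toReal / 2 * ‖e - e'‖ := by
  by_cases h : e = e'
  · simp [h]
  · rw [mixReward_update A j y (hd j), mixReward_update A j y (hd j)]
    exact abs_sum_sub_mul_le (fun a b => mixSlice_sub_le A (hj h) y hd a b) he he'

/-- Replacing the distributions of the agents one at a time. -/
lemma abs_mixReward_sub_le [∀ i, Nonempty (U i)] (y : (i : Fin N) → Y i)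
    {d d' : (i : Fin N) → ActVec (U i)} (hd : ∀ i, d i ∈ simplex (U i))
    (hd' : ∀ i, d' i ∈ simplex (U i)) (hosc : ∀ i, d i ≠ d' i → localOsc A i ≠ ∞) :
    |mixReward A y d - mixReward A y d'|
      ≤ ∑ i, (localOsc A i).toReal / 2 * ‖d i - d' i‖ := by
  suffices h : ∀ s : Finset (Fin N), |mixReward A y (s.piecewise d d') - mixReward A y d'|
      ≤ ∑ i ∈ s, (localOsc A i).toReal / 2 * ‖d i - d' i‖ by
    simpa using h Finset.univ
  intro s
  induction s using Finset.induction_on with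
  | empty => simp
  | insert j s hj ih =>
    have hmem : ∀ i, s.piecewise d d' i ∈ simplex (U i) := fun i => by
      by_cases hi : i ∈ s
      · rw [Finset.piecewise_eq_of_mem _ _ _ hi]; exact hd i
      · rw [Finset.piecewise_eq_of_notMem _ _ _ hi]; exact hd' i
    have h1 := abs_mixReward_update_sub_le A y hmem (hd j) (hd' j) (hosc j)
    have h2 : Function.update (s.piecewise d d') j (d' j) = s.piecewise d d' := by
      rw [← Finset.piecewise_eq_of_notMem s d d' hj, Function.update_eq_self]
    rw [Finset.piecewise_insert, Finset.sum_insert hj]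
    rw [h2] at h1
    exact (abs_sub_le _ _ _).trans (add_le_add h1 ih)

lemma abs_mixSlice_sub_le [∀ i, Nonempty (U i)] (hosc : ∀ i j : Fin N, i ≠ j → localOsc A i ≠ ∞)
    (j : Fin N) (y : (i : Fin N) → Y i) {d d' : (i : Fin N) → ActVec (U i)}
    (hd : ∀ i, d i ∈ simplex (U i)) (hd' : ∀ i, d' i ∈ simplex (U i)) {D : Fin N → ℝ}
    (hD : ∀ i, ‖d i - d' i‖ ≤ D i) (a : U j) :
    |mixSlice A j y d a - mixSlice A j y d' a|
      ≤ ∑ i, (if i = j then 0 else (localOsc A i).toReal / 2) * D i := by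
  classical
  rw [mixSlice_eq_mixReward A j y (hd j), mixSlice_eq_mixReward A j y (hd' j)]
  have hmem : ∀ {d : (i : Fin N) → ActVec (U i)}, (∀ i, d i ∈ simplex (U i)) →
      ∀ i, Function.update d j (PiLp.single 1 a (1 : ℝ) : ActVec (U j)) i ∈ simplex (U i) := by
    intro d hd i
    by_cases hi : i = j
    · subst hi; rw [Function.update_self]; exact single_mem_simplex a
    · rw [Function.update_of_ne hi]; exact hd i
  refine (abs_mixReward_sub_le A y (hmem hd) (hmem hd') fun i hi => ?_).trans
    (Finset.sum_le_sum fun i _ => ?_)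
  · refine hosc i j fun h => hi ?_
    subst h
    simp
  · by_cases hi : i = j
    · subst hi; simp
    · rw [Function.update_of_ne hi, Function.update_of_ne hi, if_neg hi]
      exact mul_le_mul_of_nonneg_left (hD i) (by positivity)

end Reward

/-! ### Measurability and integrability of mixed rewards -/

lemma measurable_coord {α β : Type*} [MeasurableSpace β] {f : β → ActVec α} (hf : Measurable f)
    (a : α) : Measurable fun y => f y a :=
  (measurable_pi_apply a).comp ((WithLp.measurable_ofLp 1 _).comp hf)

lemma update_eq_update_of_subsingleton {ι : Type*} [DecidableEq ι] [Subsingleton ι]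
    {E : ι → Type*} (f f' : (i : ι) → E i) {j : ι} (x : E j) :
    Function.update f j x = Function.update f' j x := by
  funext i
  obtain rfl := Subsingleton.elim i j
  simp

section BestResponse

variable {N : ℕ} {X : Type*} {Y U : Fin N → Type*} [MeasurableSpace X]
  [∀ i, MeasurableSpace (Y i)] [∀ i, Fintype (U i)] {T : Team N X Y U} (A : AbsCont T)

lemma IsPolicy.update {g : Profile Y U} (hg : IsPolicy g) (j : Fin N) {h : Y j → ActVec (U j)}
    (hm : Measurable h) (hs : ∀ y, h y ∈ simplex (U j)) :
    IsPolicy (Function.update g j h) := by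
  intro i
  by_cases hi : i = j
  · subst hi; rw [Function.update_self]; exact ⟨hm, hs⟩
  · rw [Function.update_of_ne hi]; exact hg i

lemma IsPolicy.measurable_prod {g : Profile Y U} (hg : IsPolicy g) (u : (i : Fin N) → U i) :
    Measurable fun y : (i : Fin N) → Y i => ∏ i, g i (y i) (u i) :=
  Finset.measurable_prod _ fun i _ =>
    (measurable_coord (hg i).1 (u i)).comp (measurable_pi_apply i)

lemma measurable_mixReward {g : Profile Y U} (hg : IsPolicy g) :
    Measurable fun y => mixReward A y fun i => g i (y i) :=
  Finset.measurable_sum _ fun u _ => (measurable_redReward A u).mul (hg.measurable_prod u)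

lemma measurable_mixSlice {g : Profile Y U} (hg : IsPolicy g) (j : Fin N) (a : U j) :
    Measurable fun q : Y j × ((i : Fin N) → Y i) =>
      mixSlice A j (Function.update q.2 j q.1) (fun i => g i (q.2 i)) a :=
  Finset.measurable_sum _ fun u _ =>
    ((measurable_redReward A _).comp (measurable_update_uncurry j)).mul
      ((hg.measurable_prod u).comp measurable_snd)

lemma measurable_mixSlice_right {g : Profile Y U} (hg : IsPolicy g) {j : Fin N} (yj : Y j)
    (a : U j) : Measurable fun y : (i : Fin N) → Y i =>
      mixSlice A j (Function.update y j yj) (fun i => g i (y i)) a :=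
  Finset.measurable_sum _ fun u _ =>
    ((measurable_redReward A _).comp measurable_update_left).mul (hg.measurable_prod u)

lemma abs_mixReward_le (y : (i : Fin N) → Y i) {d : (i : Fin N) → ActVec (U i)}
    (hd : ∀ i, d i ∈ simplex (U i)) :
    |mixReward A y d| ≤ ∑ u : ((i : Fin N) → U i), redReward A y u := by
  refine (Finset.abs_sum_le_sum_abs _ _).trans (Finset.sum_le_sum fun u _ => ?_)
  have h0 : 0 ≤ ∏ i, d i (u i) := Finset.prod_nonneg fun i _ => (hd i).1 _
  rw [abs_mul, abs_of_nonneg (redReward_nonneg A y u), abs_of_nonneg h0]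
  exact mul_le_of_le_one_right (redReward_nonneg A y u)
    (Finset.prod_le_one (fun i _ => (hd i).1 _) fun i _ => le_one_of_mem_simplex (hd i) _)

lemma integrable_mixReward (hJ : ∀ g : Profile Y U, IsPolicy g → expReward T g ≠ ∞)
    {g : Profile Y U} (hg : IsPolicy g) :
    Integrable (fun y => mixReward A y fun i => g i (y i)) (Measure.pi A.ref) :=
  (integrable_finsetSum Finset.univ fun u _ => integrable_redReward A hJ u).mono'
    (measurable_mixReward A hg).aestronglyMeasurable
    (ae_of_all _ fun y => abs_mixReward_le A y fun i => (hg i).2 _)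

/-- If there are at least two agents, then all oscillations are finite, so that two slices differ
by a bounded function; for a single agent, the slice does not depend on the integration variable.
Hence at a given observation of agent `j` the integrals defining its objective either all converge
or all diverge. -/
lemma integrable_mixSlice_of [∀ i, Nonempty (U i)]
    (hosc : ∀ i j : Fin N, i ≠ j → localOsc A i ≠ ∞) {g g' : Profile Y U} (hg : IsPolicy g)
    (hg' : IsPolicy g') (j : Fin N) (yj : Y j) (a b : U j)
    (hi : Integrable (fun y => mixSlice A j (Function.update y j yj) (fun i => g i (y i)) a)
      (Measure.pi A.ref)) :
    Integrable (fun y => mixSlice A j (Function.update y j yj) (fun i => g' i (y i)) b)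
      (Measure.pi A.ref) := by
  classical
  rcases subsingleton_or_nontrivial (Fin N) with hN | hN
  · obtain ⟨y₀⟩ : Nonempty ((i : Fin N) → Y i) :=
      nonempty_of_isProbabilityMeasure (Measure.pi A.ref)
    refine (integrable_const (mixSlice A j (Function.update y₀ j yj)
      (fun i => g' i (y₀ i)) b)).congr (ae_of_all _ fun y => ?_)
    beta_reduce
    rw [mixSlice_eq_mixReward A j _ ((hg' j).2 (y₀ j)),
      mixSlice_eq_mixReward A j _ ((hg' j).2 (y j)),
      update_eq_update_of_subsingleton y y₀ yj,
      update_eq_update_of_subsingleton (fun i => g' i (y i)) (fun i => g' i (y₀ i)) _]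
  · have hfin : ∀ i, localOsc A i ≠ ∞ := fun i => by
      obtain ⟨k, hk⟩ := exists_ne i
      exact hosc i k hk.symm
    have hmem : ∀ {g : Profile Y U}, IsPolicy g → ∀ (y : (i : Fin N) → Y i) (a : U j) i,
        Function.update (fun i => g i (y i)) j (PiLp.single 1 a (1 : ℝ) : ActVec (U j)) i
          ∈ simplex (U i) := by
      intro g hg y a i
      by_cases hi : i = j
      · subst hi; rw [Function.update_self]; exact single_mem_simplex a
      · rw [Function.update_of_ne hi]; exact (hg i).2 _
    have hdiff : Integrable (fun y =>
        mixSlice A j (Function.update y j yj) (fun i => g' i (y i)) b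
          - mixSlice A j (Function.update y j yj) (fun i => g i (y i)) a)
        (Measure.pi A.ref) := by
      refine Integrable.of_bound ((measurable_mixSlice_right A hg' yj b).sub
        (measurable_mixSlice_right A hg yj a)).aestronglyMeasurable
        (∑ i, (localOsc A i).toReal / 2 * 2) (ae_of_all _ fun y => ?_)
      rw [Real.norm_eq_abs, mixSlice_eq_mixReward A j _ ((hg' j).2 _),
        mixSlice_eq_mixReward A j _ ((hg j).2 _)]
      exact (abs_mixReward_sub_le A _ (hmem hg' y b) (hmem hg y a) fun i _ => hfin i).trans
        (Finset.sum_le_sum fun i _ => mul_le_mul_of_nonneg_left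
          (norm_sub_le_two (hmem hg' y b i) (hmem hg y a i)) (by positivity))
    exact (hdiff.add hi).congr (ae_of_all _ fun y => sub_add_cancel _ _)

/-! ### The best response operator -/

/-- The expected reward of agent `j` at the observation `yj` for each of its actions, against the
policies of the others; `0` where the integral diverges. -/
def brPayoff (g : Profile Y U) (j : Fin N) (yj : Y j) (a : U j) : ℝ :=
  ∫ y, mixSlice A j (Function.update y j yj) (fun i => g i (y i)) a ∂(Measure.pi A.ref)

variable {A} {Om : (i : Fin N) → ActVec (U i) → ℝ} {rho : Fin N → ℝ}

lemma brObjective_eq_regLin [∀ i, Nonempty (U i)]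
    (hosc : ∀ i j : Fin N, i ≠ j → localOsc A i ≠ ∞) {g : Profile Y U} (hg : IsPolicy g)
    (j : Fin N) (yj : Y j) {d : ActVec (U j)} (hd : d ∈ simplex (U j)) :
    brObjective A Om g j yj d = regLin (Om j) (brPayoff A g j yj) d := by
  unfold brObjective regLin
  congr 1
  simp only [fun y : (i : Fin N) → Y i => mixReward_update A j (Function.update y j yj)
    (d := fun i => g i (y i)) ((hg j).2 _) d]
  by_cases hint : ∃ a, Integrable
      (fun y => mixSlice A j (Function.update y j yj) (fun i => g i (y i)) a) (Measure.pi A.ref)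
  · obtain ⟨a, ha⟩ := hint
    rw [integral_finsetSum _ fun b _ =>
      (integrable_mixSlice_of A hosc hg hg j yj a b ha).const_mul (d b)]
    exact Finset.sum_congr rfl fun b _ => integral_const_mul _ _
  · -- both sides are `0`: an action of positive probability would have an integrable slice
    have h1 : ∀ b, brPayoff A g j yj b = 0 := fun b =>
      integral_undef fun hb => hint ⟨b, hb⟩
    simp only [h1, mul_zero, Finset.sum_const_zero]
    refine integral_undef fun hi => hint ?_
    obtain ⟨a, -, ha⟩ : ∃ a ∈ Finset.univ, 0 < d a := by
      by_contra! h
      have := Finset.sum_nonpos h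
      linarith [hd.2]
    refine ⟨a, (hi.const_mul (d a)⁻¹).mono'
      (measurable_mixSlice_right A hg yj a).aestronglyMeasurable
      (ae_of_all _ fun y => ?_)⟩
    have h0 : ∀ b, 0 ≤ mixSlice A j (Function.update y j yj) (fun i => g i (y i)) b :=
      fun b => mixSlice_nonneg A j _ (fun i => (hg i).2 _) b
    rw [Real.norm_of_nonneg (h0 a), ← div_eq_inv_mul, le_div_iff₀ ha, mul_comm]
    exact Finset.single_le_sum
      (f := fun b => d b * mixSlice A j (Function.update y j yj) (fun i => g i (y i)) b)
      (fun b _ => mul_nonneg (hd.1 b) (h0 b)) (Finset.mem_univ a)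

lemma bestResp_eq_regArgmax [∀ i, Nonempty (U i)]
    (hosc : ∀ i j : Fin N, i ≠ j → localOsc A i ≠ ∞) {g : Profile Y U} (hg : IsPolicy g)
    (j : Fin N) (yj : Y j) :
    bestResp A Om g j yj = regArgmax (Om j) (brPayoff A g j yj) :=
  argmaxOn_congr fun _ hd => brObjective_eq_regLin hosc hg j yj hd

lemma measurable_brPayoff {g : Profile Y U} (hg : IsPolicy g) (j : Fin N) :
    Measurable fun yj => brPayoff A g j yj :=
  measurable_pi_lambda _ fun a =>
    (measurable_mixSlice A hg j a).stronglyMeasurable.integral_prod_right'.measurable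

lemma bestResp_congr_ae {g g' : Profile Y U} (h : ∀ i, g i =ᵐ[A.ref i] g' i) :
    bestResp A Om g = bestResp A Om g' := by
  have h1 : ∀ᵐ y ∂(Measure.pi A.ref), ∀ i, g i (y i) = g' i (y i) :=
    ae_all_iff.2 fun i => (measurePreserving_eval A.ref i).quasiMeasurePreserving.ae (h i)
  have h2 : ∀ j yj, brObjective A Om g j yj = brObjective A Om g' j yj := by
    intro j yj
    funext d
    unfold brObjective
    congr 1
    refine integral_congr_ae ?_
    filter_upwards [h1] with y hy
    rw [funext hy]
  funext j yj
  rw [bestResp, bestResp, h2]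

/-- The standing assumptions on the regularizers and on the cross oscillations. -/
structure RegularTeam (A : AbsCont T) (Om : (i : Fin N) → ActVec (U i) → ℝ) (rho : Fin N → ℝ) :
    Prop where
  finite_reward : ∀ g : Profile Y U, IsPolicy g → expReward T g ≠ ∞
  rho_pos : ∀ i, 0 < rho i
  strongConvex : ∀ i, StrongConvexOn (simplex (U i)) (rho i) (Om i)
  lsc : ∀ i, LowerSemicontinuousOn (Om i) (simplex (U i))
  osc_ne_top : ∀ i j : Fin N, i ≠ j → localOsc A i ≠ ∞

namespace RegularTeam

variable [∀ i, Nonempty (U i)] (H : RegularTeam A Om rho)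

include H

lemma isPolicy_bestResp {g : Profile Y U} (hg : IsPolicy g) : IsPolicy (bestResp A Om g) := by
  intro j
  have h1 : bestResp A Om g j = fun yj => regArgmax (Om j) (brPayoff A g j yj) :=
    funext fun yj => bestResp_eq_regArgmax H.osc_ne_top hg j yj
  rw [h1]
  exact ⟨(continuous_regArgmax (H.strongConvex j) (H.rho_pos j) (H.lsc j)).measurable.comp
    (measurable_brPayoff hg j), fun yj => (regArgmax_spec (H.lsc j) _).1⟩

lemma isMaxOn_brObjective_iff {g : Profile Y U} (hg : IsPolicy g) (j : Fin N) (yj : Y j)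
    {d : ActVec (U j)} (hd : d ∈ simplex (U j)) :
    IsMaxOn (brObjective A Om g j yj) (simplex (U j)) d ↔ d = bestResp A Om g j yj := by
  rw [bestResp_eq_regArgmax H.osc_ne_top hg j yj,
    ← isMaxOn_regLin_iff (H.strongConvex j) (H.rho_pos j) (H.lsc j) hd]
  have h1 : Set.EqOn (brObjective A Om g j yj) (regLin (Om j) (brPayoff A g j yj))
      (simplex (U j)) := fun x hx => brObjective_eq_regLin H.osc_ne_top hg j yj hx
  simp only [IsMaxOn, IsMaxFilter, eventually_principal]
  exact forall₂_congr fun x hx => by rw [h1 hx, h1 hd]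

/-- A uniform distance `D` between two profiles is mapped to at most `P D`, uniformly over the
observations: the set of observations at which the payoffs diverge is the same for both. -/
lemma norm_bestResp_sub_le {g g' : Profile Y U} (hg : IsPolicy g) (hg' : IsPolicy g')
    {D : Fin N → ℝ} (hD : ∀ i y, ‖g i y - g' i y‖ ≤ D i) (j : Fin N) (yj : Y j) :
    ‖bestResp A Om g j yj - bestResp A Om g' j yj‖ ≤ ∑ i, gainMatrix A rho j i * D i := by
  rw [bestResp_eq_regArgmax H.osc_ne_top hg, bestResp_eq_regArgmax H.osc_ne_top hg']
  have : Nonempty ((i : Fin N) → Y i) :=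
    nonempty_of_isProbabilityMeasure (Measure.pi A.ref)
  have hpt : ∀ (y : (i : Fin N) → Y i) (a : U j),
      |mixSlice A j (Function.update y j yj) (fun i => g i (y i)) a
        - mixSlice A j (Function.update y j yj) (fun i => g' i (y i)) a|
      ≤ ∑ i, (if i = j then 0 else (localOsc A i).toReal / 2) * D i := fun y a =>
    abs_mixSlice_sub_le A H.osc_ne_top j _ (fun i => (hg i).2 _) (fun i => (hg' i).2 _)
      (fun i => hD i (y i)) a
  have hpay : ∀ a, |brPayoff A g j yj a - brPayoff A g' j yj a|
      ≤ ∑ i, (if i = j then 0 else (localOsc A i).toReal / 2) * D i := by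
    intro a
    by_cases hi : Integrable
        (fun y => mixSlice A j (Function.update y j yj) (fun i => g i (y i)) a) (Measure.pi A.ref)
    · have hi' := integrable_mixSlice_of A H.osc_ne_top hg hg' j yj a a hi
      rw [brPayoff, brPayoff, ← integral_sub hi hi', ← Real.norm_eq_abs]
      refine (norm_integral_le_of_norm_le_const (ae_of_all _ fun y => hpt y a)).trans ?_
      simp
    · have hi' : ¬ Integrable
          (fun y => mixSlice A j (Function.update y j yj) (fun i => g' i (y i)) a)
          (Measure.pi A.ref) := fun h =>
        hi (integrable_mixSlice_of A H.osc_ne_top hg' hg j yj a a h)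
      rw [brPayoff, brPayoff, integral_undef hi, integral_undef hi', sub_zero, abs_zero]
      exact (abs_nonneg _).trans (hpt (Classical.arbitrary _) a)
  refine (norm_regArgmax_sub_le (H.strongConvex j) (H.rho_pos j) (H.lsc j) hpay).trans
    (le_of_eq ?_)
  rw [Finset.mul_sum]
  refine Finset.sum_congr rfl fun i _ => ?_
  simp only [gainMatrix, Matrix.of_apply]
  split_ifs <;> ring

/-! ### The regularized team reward -/

lemma integrable_regularizer {j : Fin N} {h : Y j → ActVec (U j)} (hm : Measurable h)
    (hs : ∀ y, h y ∈ simplex (U j)) : Integrable (fun y => Om j (h y)) (A.ref j) := by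
  obtain ⟨C, hC⟩ := exists_abs_le_of_strongConvexOn (H.strongConvex j) (H.rho_pos j) (H.lsc j)
  exact Integrable.of_bound
    (measurable_comp_of_lowerSemicontinuousOn hm hs (H.lsc j)).aestronglyMeasurable C
    (ae_of_all _ fun y => hC _ (hs y))

lemma integrable_regularizer_pi {j : Fin N} {h : Y j → ActVec (U j)} (hm : Measurable h)
    (hs : ∀ y, h y ∈ simplex (U j)) :
    Integrable (fun y : (i : Fin N) → Y i => Om j (h (y j))) (Measure.pi A.ref) :=
  (measurePreserving_eval A.ref j).integrable_comp_of_integrable (H.integrable_regularizer hm hs)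

lemma integrable_regReward {g : Profile Y U} (hg : IsPolicy g) :
    Integrable (fun y => regReward A Om y (fun i => g i (y i))) (Measure.pi A.ref) :=
  (integrable_mixReward A H.finite_reward hg).sub
    (integrable_finsetSum _ fun i _ => H.integrable_regularizer_pi (hg i).1 (hg i).2)

lemma regJ_eq {g : Profile Y U} (hg : IsPolicy g) :
    regJ A Om g = ∫ y, mixReward A y (fun i => g i (y i)) ∂(Measure.pi A.ref)
      - ∑ i, ∫ y, Om i (g i y) ∂(A.ref i) := by
  unfold regJ regReward
  rw [integral_sub (integrable_mixReward A H.finite_reward hg)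
      (integrable_finsetSum _ fun i _ => H.integrable_regularizer_pi (hg i).1 (hg i).2),
    integral_finsetSum _ fun i _ => H.integrable_regularizer_pi (hg i).1 (hg i).2]
  congr 1
  refine Finset.sum_congr rfl fun i _ => ?_
  rw [← (measurePreserving_eval A.ref i).map_eq, integral_map (measurable_pi_apply i).aemeasurable]
  rw [(measurePreserving_eval A.ref i).map_eq]
  exact (H.integrable_regularizer (hg i).1 (hg i).2).aestronglyMeasurable

/-- Conditioning the team reward on the observation of agent `j`. -/
lemma regJ_update {g : Profile Y U} (hg : IsPolicy g) (j : Fin N) {h : Y j → ActVec (U j)}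
    (hm : Measurable h) (hs : ∀ y, h y ∈ simplex (U j)) :
    Integrable (fun yj => brObjective A Om g j yj (h yj)) (A.ref j) ∧
      regJ A Om (Function.update g j h) = ∫ yj, brObjective A Om g j yj (h yj) ∂(A.ref j)
        - ∑ i ∈ Finset.univ.erase j, ∫ y, Om i (g i y) ∂(A.ref i) := by
  have hpol := hg.update j hm hs
  have hint := integrable_mixReward A H.finite_reward hpol
  have hmp := measurePreserving_update (μ := A.ref) j
  have hint2 := hmp.integrable_comp_of_integrable hint
  have hpt : ∀ (yj : Y j) (y : (i : Fin N) → Y i),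
      (fun i => Function.update g j h i (Function.update y j yj i))
        = Function.update (fun i => g i (y i)) j (h yj) := by
    intro yj y
    funext i
    by_cases hi : i = j
    · subst hi; simp
    · simp [Function.update_of_ne hi]
  have hOm := H.integrable_regularizer hm hs
  have h1 : ∫ y, mixReward A y (fun i => Function.update g j h i (y i)) ∂(Measure.pi A.ref)
      = ∫ yj, ∫ y, mixReward A (Function.update y j yj)
        (Function.update (fun i => g i (y i)) j (h yj)) ∂(Measure.pi A.ref) ∂(A.ref j) := by
    conv_lhs => rw [← hmp.map_eq]
    rw [integral_map hmp.measurable.aemeasurable (by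
      rw [hmp.map_eq]; exact hint.aestronglyMeasurable)]
    refine (integral_prod _ hint2).trans ?_
    simp only [Function.comp_def, hpt]
  have h2 : Integrable (fun yj => ∫ y, mixReward A (Function.update y j yj)
      (Function.update (fun i => g i (y i)) j (h yj)) ∂(Measure.pi A.ref)) (A.ref j) := by
    have := hint2.integral_prod_left
    simpa only [Function.comp_def, hpt] using this
  refine ⟨h2.sub hOm, ?_⟩
  unfold brObjective
  rw [H.regJ_eq hpol, h1, integral_sub h2 hOm, ← Finset.add_sum_erase _ _ (Finset.mem_univ j),
    Function.update_self, sub_add_eq_sub_sub]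
  congr 1
  exact Finset.sum_congr rfl fun i hi => by
    rw [Function.update_of_ne (Finset.ne_of_mem_erase hi)]

lemma integrable_sq_norm_sub {g : Profile Y U} (hg : IsPolicy g) (j : Fin N)
    {h : Y j → ActVec (U j)} (hm : Measurable h) (hs : ∀ y, h y ∈ simplex (U j)) :
    Integrable (fun y => ‖h y - bestResp A Om g j y‖ ^ 2) (A.ref j) := by
  obtain ⟨hbm, hbs⟩ := H.isPolicy_bestResp hg j
  refine Integrable.of_bound ((hm.sub hbm).norm.pow_const 2).aestronglyMeasurable (2 ^ 2)
    (ae_of_all _ fun y => ?_)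
  rw [Real.norm_of_nonneg (by positivity)]
  exact pow_le_pow_left₀ (norm_nonneg _) (norm_sub_le_two (hs y) (hbs y)) 2

/-- Passing to the best response of agent `j` increases the team reward by at least the mean
square distance to it. -/
lemma regJ_update_add_le {g : Profile Y U} (hg : IsPolicy g) (j : Fin N) {h : Y j → ActVec (U j)}
    (hm : Measurable h) (hs : ∀ y, h y ∈ simplex (U j)) :
    regJ A Om (Function.update g j h)
        + rho j / 2 * ∫ y, ‖h y - bestResp A Om g j y‖ ^ 2 ∂(A.ref j)
      ≤ regJ A Om (Function.update g j (bestResp A Om g j)) := by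
  obtain ⟨hbm, hbs⟩ := H.isPolicy_bestResp hg j
  obtain ⟨hi1, he1⟩ := H.regJ_update hg j hm hs
  obtain ⟨hi2, he2⟩ := H.regJ_update hg j hbm hbs
  rw [he1, he2]
  have hi3 := H.integrable_sq_norm_sub hg j hm hs
  have key : ∫ yj, brObjective A Om g j yj (h yj) ∂(A.ref j)
        + rho j / 2 * ∫ y, ‖h y - bestResp A Om g j y‖ ^ 2 ∂(A.ref j)
      ≤ ∫ yj, brObjective A Om g j yj (bestResp A Om g j yj) ∂(A.ref j) := by
    rw [← integral_const_mul, ← integral_add hi1 (hi3.const_mul _)]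
    refine integral_mono (hi1.add (hi3.const_mul _)) hi2 fun yj => ?_
    rw [brObjective_eq_regLin H.osc_ne_top hg j yj (hs yj),
      brObjective_eq_regLin H.osc_ne_top hg j yj (hbs yj),
      bestResp_eq_regArgmax H.osc_ne_top hg j yj]
    obtain ⟨h1, h2⟩ := regArgmax_spec (H.lsc j) (brPayoff A g j yj)
    exact regLin_add_sq_le (H.strongConvex j) h1 h2 (hs yj) (H.rho_pos j).le
  linarith

lemma regJ_update_le {g : Profile Y U} (hg : IsPolicy g) (j : Fin N) {h : Y j → ActVec (U j)}
    (hm : Measurable h) (hs : ∀ y, h y ∈ simplex (U j)) :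
    regJ A Om (Function.update g j h)
      ≤ regJ A Om (Function.update g j (bestResp A Om g j)) := by
  refine le_trans ?_ (H.regJ_update_add_le hg j hm hs)
  have h1 : 0 ≤ rho j / 2 := by linarith [H.rho_pos j]
  have h2 : 0 ≤ ∫ y, ‖h y - bestResp A Om g j y‖ ^ 2 ∂(A.ref j) :=
    integral_nonneg fun y => by positivity
  linarith [mul_nonneg h1 h2]

end RegularTeam

end BestResponse

/-! ### The fixed point of the best response operator -/

section Convergence

lemma eventually_of_forall_succ {p : ℕ → Prop} {t₀ q : ℕ} (hq : t₀ ≤ q) (hp : p q)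
    (hs : ∀ t, t₀ ≤ t → p t → p (t + 1)) : ∀ᶠ t in atTop, p t := by
  filter_upwards [eventually_ge_atTop q] with t ht
  induction t, ht using Nat.le_induction with
  | base => exact hp
  | succ t ht ih => exact hs t (hq.trans ht) ih

variable {N : ℕ} {X : Type*} {Y U : Fin N → Type*} [MeasurableSpace X]
  [∀ i, MeasurableSpace (Y i)] [∀ i, Fintype (U i)]

lemma IsPolicy.of_tendsto {g : ℕ → Profile Y U} {g' : Profile Y U} (hg : ∀ k, IsPolicy (g k))
    (h : ∀ i y, Tendsto (fun k => g k i y) atTop (𝓝 (g' i y))) : IsPolicy g' := fun i =>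
  ⟨measurable_of_tendsto_metrizable (fun k => (hg k i).1) (tendsto_pi_nhds.2 (h i)), fun y =>
    isCompact_simplex.isClosed.mem_of_tendsto (h i y) (Eventually.of_forall fun k => (hg k i).2 y)⟩

variable {T : Team N X Y U} {A : AbsCont T} {Om : (i : Fin N) → ActVec (U i) → ℝ}
  {rho : Fin N → ℝ} {v : Fin N → ℝ} {θ : ℝ}

lemma tendsto_normVec_sub_zero {g : ℕ → Profile Y U} {gs : Profile Y U} (hθ : 0 ≤ θ)
    (hθ1 : θ < 1)
    (h : ∀ k : ℕ, ∀ᶠ t in atTop, ∀ i y, ‖g t i y - gs i y‖ ≤ 2 * θ ^ k * v i) :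
    Tendsto (fun t => normVec A.ref (g t - gs)) atTop (𝓝 0) := by
  refine tendsto_pi_nhds.2 fun i => ?_
  have h0 : Tendsto (fun k : ℕ => 2 * θ ^ k * v i) atTop (𝓝 0) := by
    simpa using ((tendsto_pow_atTop_nhds_zero_of_lt_one hθ hθ1).const_mul 2).mul_const (v i)
  rw [Metric.tendsto_nhds]
  intro ε hε
  obtain ⟨k, hk⟩ := (h0.eventually_lt_const hε).exists
  filter_upwards [h k] with t ht
  have h1 : 0 ≤ normVec A.ref (g t - gs) i := integral_nonneg fun y => norm_nonneg _
  have h2 : normVec A.ref (g t - gs) i ≤ ∫ _, 2 * θ ^ k * v i ∂(A.ref i) :=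
    integral_mono_of_nonneg (ae_of_all _ fun y => norm_nonneg _) (integrable_const _)
      (ae_of_all _ fun y => ht i y)
  simp only [integral_const, probReal_univ, one_smul] at h2
  rw [Pi.zero_apply, Real.dist_eq, sub_zero, abs_of_nonneg h1]
  exact h2.trans_lt hk

/-- Dominated convergence: mixed rewards are continuous and dominated by `∑ u, r(·, u)`. -/
lemma tendsto_integral_mixReward (hJ : ∀ g : Profile Y U, IsPolicy g → expReward T g ≠ ∞)
    {g : ℕ → Profile Y U} {g' : Profile Y U}
    (hg : ∀ k, IsPolicy (g k)) (hlim : ∀ i y, Tendsto (fun k => g k i y) atTop (𝓝 (g' i y))) :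
    Tendsto (fun k => ∫ y, mixReward A y (fun i => g k i (y i)) ∂(Measure.pi A.ref)) atTop
      (𝓝 (∫ y, mixReward A y (fun i => g' i (y i)) ∂(Measure.pi A.ref))) := by
  refine tendsto_integral_of_dominated_convergence
    (fun y => ∑ u : ((i : Fin N) → U i), redReward A y u)
    (fun k => (measurable_mixReward A (hg k)).aestronglyMeasurable)
    (integrable_finsetSum Finset.univ fun u _ => integrable_redReward A hJ u)
    (fun k => ae_of_all _ fun y => abs_mixReward_le A y fun i => (hg k i).2 _)
    (ae_of_all _ fun y => ?_)
  refine tendsto_finsetSum _ fun u _ => Tendsto.const_mul _ (tendsto_finsetProd _ fun i _ => ?_)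
  have hc : Continuous fun d : ActVec (U i) => d (u i) := by fun_prop
  exact (hc.tendsto _).comp (hlim i (y i))

variable [∀ i, Nonempty (U i)]

lemma exists_isPolicy : ∃ g : Profile Y U, IsPolicy g := by
  choose d hd using fun i => simplex_nonempty (α := U i)
  exact ⟨fun i _ => d i, fun i => ⟨measurable_const, fun _ => hd i⟩⟩

namespace RegularTeam

variable (H : RegularTeam A Om rho)

include H

lemma norm_bestResp_sub_le_mul (hPv : ∀ j, ∑ i, gainMatrix A rho j i * v i ≤ θ * v j)
    {g g' : Profile Y U} (hg : IsPolicy g) (hg' : IsPolicy g') {K : ℝ} (hK : 0 ≤ K)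
    (hD : ∀ i y, ‖g i y - g' i y‖ ≤ K * v i) (j : Fin N) (yj : Y j) :
    ‖bestResp A Om g j yj - bestResp A Om g' j yj‖ ≤ K * θ * v j := by
  refine (H.norm_bestResp_sub_le hg hg' hD j yj).trans ?_
  have h1 : ∑ i, gainMatrix A rho j i * (K * v i) = K * ∑ i, gainMatrix A rho j i * v i := by
    rw [Finset.mul_sum]
    exact Finset.sum_congr rfl fun i _ => by ring
  rw [h1, mul_assoc]
  exact mul_le_mul_of_nonneg_left (hPv j) hK

lemma norm_iterate_sub_le (hv : ∀ i, 1 ≤ v i) (hθ : 0 ≤ θ)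
    (hPv : ∀ j, ∑ i, gainMatrix A rho j i * v i ≤ θ * v j) {g g' : ℕ → Profile Y U}
    (hg : ∀ k, IsPolicy (g k)) (hg' : ∀ k, IsPolicy (g' k))
    (hgs : ∀ k, g (k + 1) = bestResp A Om (g k))
    (hgs' : ∀ k, g' (k + 1) = bestResp A Om (g' k)) (k : ℕ) (i : Fin N) (y : Y i) :
    ‖g k i y - g' k i y‖ ≤ 2 * θ ^ k * v i := by
  induction k generalizing i with
  | zero =>
    have := norm_sub_le_two ((hg 0 i).2 y) ((hg' 0 i).2 y)
    rw [pow_zero, mul_one]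
    linarith [hv i]
  | succ k ih =>
    rw [hgs, hgs', pow_succ, ← mul_assoc]
    exact H.norm_bestResp_sub_le_mul hPv (hg k) (hg' k) (by positivity) ih i y

lemma isPolicy_of_iterates {g : ℕ → Profile Y U} (h0 : IsPolicy (g 0))
    (hgs : ∀ k, g (k + 1) = bestResp A Om (g k)) (k : ℕ) : IsPolicy (g k) := by
  induction k with
  | zero => exact h0
  | succ k ih => rw [hgs]; exact H.isPolicy_bestResp ih

/-- The iterates from any policy are uniformly Cauchy, because each step contracts the weighted
sup norm by `θ`; their limit is fixed. -/
lemma exists_fixedPoint (hv : ∀ i, 1 ≤ v i) (hθ : 0 ≤ θ) (hθ1 : θ < 1)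
    (hPv : ∀ j, ∑ i, gainMatrix A rho j i * v i ≤ θ * v j) :
    ∃ gs : Profile Y U, IsPolicy gs ∧ bestResp A Om gs = gs := by
  obtain ⟨g₀, hg₀⟩ := exists_isPolicy (Y := Y) (U := U)
  let g : ℕ → Profile Y U := fun k => (bestResp A Om)^[k] g₀
  have hgs : ∀ k, g (k + 1) = bestResp A Om (g k) := fun k => Function.iterate_succ_apply' _ _ _
  have hg : ∀ k, IsPolicy (g k) := H.isPolicy_of_iterates hg₀ hgs
  have hstep : ∀ i y k, dist (g k i y) (g (k + 1) i y) ≤ 2 * v i * θ ^ k := fun i y k => by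
    rw [dist_eq_norm]
    refine (H.norm_iterate_sub_le hv hθ hPv (g' := fun k => g (k + 1)) hg (fun k => hg _) hgs
      (fun k => hgs _) k i y).trans (le_of_eq (by ring))
  have hlim : ∀ i y, ∃ d, Tendsto (fun k => g k i y) atTop (𝓝 d) := fun i y =>
    cauchySeq_tendsto_of_complete (cauchySeq_of_le_geometric θ (2 * v i) hθ1 (hstep i y))
  choose gs hlim using hlim
  have hpol : IsPolicy gs := IsPolicy.of_tendsto hg hlim
  refine ⟨gs, hpol, ?_⟩
  have hdist : ∀ k i y, ‖g k i y - gs i y‖ ≤ 2 / (1 - θ) * θ ^ k * v i := fun k i y => by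
    rw [← dist_eq_norm]
    refine (dist_le_of_le_geometric_of_tendsto θ (2 * v i) hθ1 (hstep i y) (hlim i y) k).trans
      (le_of_eq (by ring))
  have h1θ : 0 < 1 - θ := by linarith
  funext j y
  refine tendsto_nhds_unique (tendsto_iff_norm_sub_tendsto_zero.2 ?_)
    ((tendsto_add_atTop_iff_nat 1).2 (hlim j y))
  refine squeeze_zero (fun k => norm_nonneg _) (fun k => ?_)
    (g := fun k => 2 / (1 - θ) * θ ^ k * θ * v j) ?_
  · rw [hgs]
    exact H.norm_bestResp_sub_le_mul hPv (hg k) hpol (by positivity) (hdist k) j y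
  · simpa using (((tendsto_pow_atTop_nhds_zero_of_lt_one hθ hθ1).const_mul
      (2 / (1 - θ))).mul_const θ).mul_const (v j)

variable {gs : Profile Y U}

lemma norm_iterate_sub_fixedPoint_le (hv : ∀ i, 1 ≤ v i) (hθ : 0 ≤ θ)
    (hPv : ∀ j, ∑ i, gainMatrix A rho j i * v i ≤ θ * v j) (hgs : IsPolicy gs)
    (hfix : bestResp A Om gs = gs) {g : ℕ → Profile Y U} (h0 : IsPolicy (g 0))
    (hg : ∀ k, g (k + 1) = bestResp A Om (g k)) (k : ℕ) (i : Fin N) (y : Y i) :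
    ‖g k i y - gs i y‖ ≤ 2 * θ ^ k * v i :=
  H.norm_iterate_sub_le hv hθ hPv (g' := fun _ => gs) (H.isPolicy_of_iterates h0 hg)
    (fun _ => hgs) hg (fun _ => hfix.symm) k i y

lemma tendsto_iterate (hv : ∀ i, 1 ≤ v i) (hθ : 0 ≤ θ) (hθ1 : θ < 1)
    (hPv : ∀ j, ∑ i, gainMatrix A rho j i * v i ≤ θ * v j) (hgs : IsPolicy gs)
    (hfix : bestResp A Om gs = gs) {g : ℕ → Profile Y U} (h0 : IsPolicy (g 0))
    (hg : ∀ k, g (k + 1) = bestResp A Om (g k)) :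
    Tendsto (fun k => normVec A.ref (g k - gs)) atTop (𝓝 0) := by
  refine tendsto_normVec_sub_zero hθ hθ1 (v := v) fun k => ?_
  filter_upwards [eventually_ge_atTop k] with t ht i y
  refine (H.norm_iterate_sub_fixedPoint_le hv hθ hPv hgs hfix h0 hg t i y).trans ?_
  have h1 : θ ^ t ≤ θ ^ k := pow_le_pow_of_le_one hθ hθ1.le ht
  have h2 : 0 ≤ v i := zero_le_one.trans (hv i)
  gcongr

lemma eq_of_fixed (hv : ∀ i, 1 ≤ v i) (hθ : 0 ≤ θ) (hθ1 : θ < 1)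
    (hPv : ∀ j, ∑ i, gainMatrix A rho j i * v i ≤ θ * v j) (hgs : IsPolicy gs)
    (hfix : bestResp A Om gs = gs) {h : Profile Y U} (hh : IsPolicy h)
    (hhfix : bestResp A Om h = h) : h = gs := by
  funext i y
  have h0 : Tendsto (fun k : ℕ => 2 * θ ^ k * v i) atTop (𝓝 0) := by
    simpa using ((tendsto_pow_atTop_nhds_zero_of_lt_one hθ hθ1).const_mul 2).mul_const (v i)
  have h1 : ‖h i y - gs i y‖ ≤ 0 := ge_of_tendsto' h0 fun k =>
    H.norm_iterate_sub_fixedPoint_le hv hθ hPv hgs hfix (g := fun _ => h) hh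
      (fun _ => hhfix.symm) k i y
  exact sub_eq_zero.1 (norm_le_zero_iff.1 h1)

/-! ### The asynchronous algorithm -/

lemma isPolicy_mem {s : ℕ → Fin N → Activity N} {mem : ℕ → Fin N → Profile Y U}
    (hrun : IsAsyncRun (bestResp A Om) s mem) (t : ℕ) (j : Fin N) : IsPolicy (mem t j) := by
  induction t generalizing j with
  | zero => exact hrun.1 j
  | succ t ih =>
    intro i
    by_cases hij : i = j
    · subst hij
      rw [(hrun.2 t).1]
      split_ifs
      · exact H.isPolicy_bestResp (ih i) i
      · exact ih i i
    · rw [(hrun.2 t).2 i j hij]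
      split_ifs
      · exact ih i i
      · exact ih j i

/-- Once every memory entry is within `K v` of the fixed point, each agent computes at least once,
after which its own policy stays within `K θ v`; then it transmits this policy to every other
agent, after which all memory entries stay within `K θ v`. -/
lemma eventually_mem_step (hPv : ∀ j, ∑ i, gainMatrix A rho j i * v i ≤ θ * v j)
    (hgs : IsPolicy gs) (hfix : bestResp A Om gs = gs)
    {s : ℕ → Fin N → Activity N} {mem : ℕ → Fin N → Profile Y U} (hs : FairSchedule s)
    (hrun : IsAsyncRun (bestResp A Om) s mem) {K : ℝ} (hK : 0 ≤ K)
    (h : ∀ᶠ t in atTop, ∀ j i y, ‖mem t j i y - gs i y‖ ≤ K * v i) :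
    ∀ᶠ t in atTop, ∀ j i y, ‖mem t j i y - gs i y‖ ≤ K * θ * v i := by
  obtain ⟨t₀, ht₀⟩ := eventually_atTop.1 h
  have hcomp : ∀ i t, t₀ ≤ t → ∀ y,
      ‖bestResp A Om (mem t i) i y - gs i y‖ ≤ K * θ * v i := fun i t ht y => by
    have := H.norm_bestResp_sub_le_mul hPv (H.isPolicy_mem hrun t i) hgs hK (ht₀ t ht i) i y
    rwa [hfix] at this
  have hown : ∀ᶠ t in atTop, ∀ i y, ‖mem t i i y - gs i y‖ ≤ K * θ * v i := by
    refine eventually_all.2 fun i => ?_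
    obtain ⟨_, _, ⟨q, hq, _, hc⟩, _⟩ := hs i t₀
    obtain ⟨q, rfl⟩ := Nat.exists_eq_add_of_lt hq
    refine eventually_of_forall_succ (Nat.le_add_right t₀ (q + 1)) ?_ fun t ht ih => ?_
    · intro y
      rw [← add_assoc, (hrun.2 (t₀ + q)).1 i, if_pos hc]
      exact hcomp i _ (Nat.le_add_right _ _) y
    · intro y
      rw [(hrun.2 t).1 i]
      split_ifs
      · exact hcomp i t ht y
      · exact ih y
  obtain ⟨t₁, ht₁⟩ := eventually_atTop.1 hown
  refine eventually_all.2 fun j => eventually_all.2 fun i => ?_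
  by_cases hij : i = j
  · subst hij
    exact hown.mono fun t ht => ht i
  · obtain ⟨_, _, _, htr⟩ := hs i t₁
    obtain ⟨q, hq, _, hc⟩ := htr j (Ne.symm hij)
    obtain ⟨q, rfl⟩ := Nat.exists_eq_add_of_lt hq
    refine eventually_of_forall_succ (Nat.le_add_right t₁ (q + 1)) ?_ fun t ht ih => ?_
    · intro y
      rw [← add_assoc, (hrun.2 (t₁ + q)).2 i j hij, if_pos hc]
      exact ht₁ _ (Nat.le_add_right _ _) i y
    · intro y
      rw [(hrun.2 t).2 i j hij]
      split_ifs
      · exact ht₁ t ht i y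
      · exact ih y

lemma tendsto_async (hv : ∀ i, 1 ≤ v i) (hθ : 0 ≤ θ) (hθ1 : θ < 1)
    (hPv : ∀ j, ∑ i, gainMatrix A rho j i * v i ≤ θ * v j) (hgs : IsPolicy gs)
    (hfix : bestResp A Om gs = gs) {s : ℕ → Fin N → Activity N}
    {mem : ℕ → Fin N → Profile Y U} (hs : FairSchedule s)
    (hrun : IsAsyncRun (bestResp A Om) s mem) :
    Tendsto (fun t => normVec A.ref ((fun j => mem t j j) - gs)) atTop (𝓝 0) := by
  have key : ∀ k : ℕ, ∀ᶠ t in atTop, ∀ j i y,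
      ‖mem t j i y - gs i y‖ ≤ 2 * θ ^ k * v i := by
    intro k
    induction k with
    | zero =>
      refine Eventually.of_forall fun t j i y => ?_
      have := norm_sub_le_two ((H.isPolicy_mem hrun t j i).2 y) ((hgs i).2 y)
      rw [pow_zero, mul_one]
      linarith [hv i]
    | succ k ih =>
      have := H.eventually_mem_step hPv hgs hfix hs hrun (by positivity) ih
      simpa only [pow_succ, ← mul_assoc] using this
  exact tendsto_normVec_sub_zero hθ hθ1 (g := fun t j => mem t j j) fun k =>
    (key k).mono fun t ht i => ht i i

/-! ### Optimality of the fixed point -/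

/-- One Gauss–Seidel sweep: the agents pass to their best responses one after the other. -/
lemma exists_sweep (hv : ∀ i, 1 ≤ v i) (hθ1 : θ < 1)
    (hPv : ∀ j, ∑ i, gainMatrix A rho j i * v i ≤ θ * v j) (hgs : IsPolicy gs)
    (hfix : bestResp A Om gs = gs) {g : Profile Y U} (hg : IsPolicy g) {K : ℝ} (hK : 0 ≤ K)
    (hD : ∀ i y, ‖g i y - gs i y‖ ≤ K * v i) :
    ∃ g' : Profile Y U, IsPolicy g' ∧ regJ A Om g ≤ regJ A Om g' ∧
      ∀ i y, ‖g' i y - gs i y‖ ≤ K * θ * v i := by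
  suffices h : ∀ s : Finset (Fin N), ∃ g' : Profile Y U, IsPolicy g' ∧
      regJ A Om g ≤ regJ A Om g' ∧ (∀ i y, ‖g' i y - gs i y‖ ≤ K * v i) ∧
      ∀ i ∈ s, ∀ y, ‖g' i y - gs i y‖ ≤ K * θ * v i by
    obtain ⟨g', h1, h2, -, h3⟩ := h Finset.univ
    exact ⟨g', h1, h2, fun i => h3 i (Finset.mem_univ i)⟩
  intro s
  induction s using Finset.induction_on with
  | empty => exact ⟨g, hg, le_rfl, hD, by simp⟩
  | insert j s hj ih =>
    obtain ⟨g', h1, h2, h3, h4⟩ := ih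
    obtain ⟨hbm, hbs⟩ := H.isPolicy_bestResp h1 j
    have h5 : ∀ y, ‖bestResp A Om g' j y - gs j y‖ ≤ K * θ * v j := fun y => by
      have := H.norm_bestResp_sub_le_mul hPv h1 hgs hK h3 j y
      rwa [hfix] at this
    have h6 : K * θ * v j ≤ K * v j :=
      mul_le_mul_of_nonneg_right (mul_le_of_le_one_right hK hθ1.le) (zero_le_one.trans (hv j))
    refine ⟨Function.update g' j (bestResp A Om g' j), h1.update j hbm hbs, h2.trans ?_,
      fun i y => ?_, fun i hi y => ?_⟩
    · have := H.regJ_update_le h1 j (h1 j).1 (h1 j).2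
      rwa [Function.update_eq_self] at this
    · by_cases hi : i = j
      · subst hi; rw [Function.update_self]; exact (h5 y).trans h6
      · rw [Function.update_of_ne hi]; exact h3 i y
    · by_cases hij : i = j
      · subst hij; rw [Function.update_self]; exact h5 y
      · rw [Function.update_of_ne hij]
        exact h4 i (Finset.mem_of_mem_insert_of_ne hi hij) y

lemma exists_sweeps (hv : ∀ i, 1 ≤ v i) (hθ : 0 ≤ θ) (hθ1 : θ < 1)
    (hPv : ∀ j, ∑ i, gainMatrix A rho j i * v i ≤ θ * v j) (hgs : IsPolicy gs)
    (hfix : bestResp A Om gs = gs) {g : Profile Y U} (hg : IsPolicy g) (k : ℕ) :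
    ∃ g' : Profile Y U, IsPolicy g' ∧ regJ A Om g ≤ regJ A Om g' ∧
      ∀ i y, ‖g' i y - gs i y‖ ≤ 2 * θ ^ k * v i := by
  induction k with
  | zero =>
    refine ⟨g, hg, le_rfl, fun i y => ?_⟩
    have := norm_sub_le_two ((hg i).2 y) ((hgs i).2 y)
    rw [pow_zero, mul_one]
    linarith [hv i]
  | succ k ih =>
    obtain ⟨g₁, h1, h2, h3⟩ := ih
    obtain ⟨g₂, h4, h5, h6⟩ := H.exists_sweep hv hθ1 hPv hgs hfix h1 (by positivity) h3
    refine ⟨g₂, h4, h2.trans h5, fun i y => (h6 i y).trans (le_of_eq ?_)⟩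
    rw [pow_succ]
    ring

/-- Since `gs j` is a best response to `gs`, exchanging it for `h j` decreases the team reward.
This bounds the regularizers of `gs` by those of `h`, up to a difference of mixed rewards. -/
lemma regJ_le_of_fixed (hgs : IsPolicy gs) (hfix : bestResp A Om gs = gs) {h : Profile Y U}
    (hh : IsPolicy h) :
    regJ A Om h ≤ regJ A Om gs
      + (∫ y, mixReward A y (fun i => h i (y i)) ∂(Measure.pi A.ref)
        - ∫ y, mixReward A y (fun i => gs i (y i)) ∂(Measure.pi A.ref))
      + ∑ j, (∫ y, mixReward A y (fun i => gs i (y i)) ∂(Measure.pi A.ref)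
        - ∫ y, mixReward A y (fun i => Function.update gs j (h j) i (y i))
          ∂(Measure.pi A.ref)) := by
  have key : ∀ j, ∫ y, Om j (gs j y) ∂(A.ref j) - ∫ y, Om j (h j y) ∂(A.ref j)
      ≤ ∫ y, mixReward A y (fun i => gs i (y i)) ∂(Measure.pi A.ref)
        - ∫ y, mixReward A y (fun i => Function.update gs j (h j) i (y i))
          ∂(Measure.pi A.ref) := by
    intro j
    have h1 := H.regJ_update_le hgs j (hh j).1 (hh j).2
    rw [hfix, Function.update_eq_self, H.regJ_eq hgs,
      H.regJ_eq (hgs.update j (hh j).1 (hh j).2),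
      ← Finset.add_sum_erase _ _ (Finset.mem_univ j), Function.update_self,
      ← Finset.add_sum_erase _ (fun i => ∫ y, Om i (gs i y) ∂(A.ref i)) (Finset.mem_univ j)] at h1
    have h2 : ∑ i ∈ Finset.univ.erase j, ∫ y, Om i (Function.update gs j (h j) i y) ∂(A.ref i)
        = ∑ i ∈ Finset.univ.erase j, ∫ y, Om i (gs i y) ∂(A.ref i) :=
      Finset.sum_congr rfl fun i hi => by rw [Function.update_of_ne (Finset.ne_of_mem_erase hi)]
    rw [h2] at h1
    linarith
  have h3 := Finset.sum_le_sum fun j (_ : j ∈ Finset.univ) => key j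
  rw [Finset.sum_sub_distrib] at h3
  rw [H.regJ_eq hgs, H.regJ_eq hh]
  linarith

lemma isOptimal_of_fixed (hv : ∀ i, 1 ≤ v i) (hθ : 0 ≤ θ) (hθ1 : θ < 1)
    (hPv : ∀ j, ∑ i, gainMatrix A rho j i * v i ≤ θ * v j) (hgs : IsPolicy gs)
    (hfix : bestResp A Om gs = gs) : IsOptimal A Om gs := by
  refine ⟨hgs, fun h hh => ?_⟩
  choose g hg hJg hD using H.exists_sweeps hv hθ hθ1 hPv hgs hfix hh
  have hlim : ∀ i y, Tendsto (fun k => g k i y) atTop (𝓝 (gs i y)) := fun i y => by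
    refine tendsto_iff_norm_sub_tendsto_zero.2
      (squeeze_zero (fun k => norm_nonneg _) (fun k => hD k i y) ?_)
    simpa using ((tendsto_pow_atTop_nhds_zero_of_lt_one hθ hθ1).const_mul 2).mul_const (v i)
  have h1 := tendsto_integral_mixReward (A := A) H.finite_reward hg hlim
  have h2 : ∀ j, Tendsto (fun k => ∫ y, mixReward A y
      (fun i => Function.update gs j (g k j) i (y i)) ∂(Measure.pi A.ref)) atTop
      (𝓝 (∫ y, mixReward A y (fun i => gs i (y i)) ∂(Measure.pi A.ref))) := fun j =>
    tendsto_integral_mixReward (A := A) H.finite_reward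
      (fun k => hgs.update j (hg k j).1 (hg k j).2) fun i y => by
      by_cases hi : i = j
      · subst hi; simpa using hlim i y
      · simp [Function.update_of_ne hi]
  have h3 := ((h1.sub_const (∫ y, mixReward A y (fun i => gs i (y i))
    ∂(Measure.pi A.ref))).const_add (regJ A Om gs)).add
    (tendsto_finsetSum Finset.univ fun j _ => (h2 j).const_sub
      (∫ y, mixReward A y (fun i => gs i (y i)) ∂(Measure.pi A.ref)))
  simp only [sub_self, Finset.sum_const_zero, add_zero] at h3
  exact ge_of_tendsto' h3 fun k => (hJg k).trans (H.regJ_le_of_fixed hgs hfix (hg k))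

/-- An optimal rule agrees almost everywhere with its best response, which is therefore fixed. -/
lemma ae_eq_of_isOptimal (hv : ∀ i, 1 ≤ v i) (hθ : 0 ≤ θ) (hθ1 : θ < 1)
    (hPv : ∀ j, ∑ i, gainMatrix A rho j i * v i ≤ θ * v j) (hgs : IsPolicy gs)
    (hfix : bestResp A Om gs = gs) {h : Profile Y U} (hh : IsOptimal A Om h) (i : Fin N) :
    h i =ᵐ[A.ref i] gs i := by
  obtain ⟨hpol, hopt⟩ := hh
  have hb := H.isPolicy_bestResp hpol
  have hae : ∀ j, h j =ᵐ[A.ref j] bestResp A Om h j := by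
    intro j
    have h1 := H.regJ_update_add_le hpol j (hpol j).1 (hpol j).2
    rw [Function.update_eq_self] at h1
    have h2 := hopt _ (hpol.update j (hb j).1 (hb j).2)
    have h3 : ∫ y, ‖h j y - bestResp A Om h j y‖ ^ 2 ∂(A.ref j) ≤ 0 := by
      by_contra! h4
      have := mul_pos (half_pos (H.rho_pos j)) h4
      linarith
    have h5 : 0 ≤ fun y => ‖h j y - bestResp A Om h j y‖ ^ 2 := fun y => by positivity
    have h6 := (integral_eq_zero_iff_of_nonneg h5
      (H.integrable_sq_norm_sub hpol j (hpol j).1 (hpol j).2)).1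
      (le_antisymm h3 (integral_nonneg h5))
    filter_upwards [h6] with y hy
    exact sub_eq_zero.1 (norm_eq_zero.1 (pow_eq_zero_iff two_ne_zero |>.1 hy))
  have h7 : bestResp A Om h = gs :=
    H.eq_of_fixed hv hθ hθ1 hPv hgs hfix hb (bestResp_congr_ae hae).symm
  rw [← h7]
  exact hae i

end RegularTeam

end Convergence

end RegTeam

end

theorem theorem3 {N : ℕ} {X : Type*} {Y U : Fin N → Type*}
    [MeasurableSpace X] [StandardBorelSpace X]
    [∀ i, MeasurableSpace (Y i)] [∀ i, StandardBorelSpace (Y i)]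
    [∀ i, Fintype (U i)] [∀ i, Nonempty (U i)]
    (T : RegTeam.Team N X Y U) (A : RegTeam.AbsCont T)
    -- the reduced reward is real-valued and every policy has finite expected reward
    (hr : ∀ y u, RegTeam.redRewardENN A y u ≠ ∞)
    (hJ : ∀ g : RegTeam.Profile Y U, RegTeam.IsPolicy g → RegTeam.expReward T g ≠ ∞)
    -- the regularizers are strongly convex for the `ℓ¹` norm, and closed
    (rho : Fin N → ℝ) (hrho : ∀ i, 0 < rho i)
    (Om : (i : Fin N) → RegTeam.ActVec (U i) → ℝ)
    (hOm : ∀ i, StrongConvexOn (RegTeam.simplex (U i)) (rho i) (Om i))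
    (hlsc : ∀ i, LowerSemicontinuousOn (Om i) (RegTeam.simplex (U i)))
    (hP : RegTeam.SmallGain A rho) :
    -- the regularized reward of every policy is a convergent integral
    (∀ g : RegTeam.Profile Y U, RegTeam.IsPolicy g →
      Integrable (fun y => RegTeam.regReward A Om y (fun i => g i (y i)))
        (Measure.pi A.ref)) ∧
    -- the best response operator is a well-defined single-valued map of the policies to themselves
    (∀ g : RegTeam.Profile Y U, RegTeam.IsPolicy g →
      RegTeam.IsPolicy (RegTeam.bestResp A Om g) ∧
      ∀ (j : Fin N) (yj : Y j), ∀ d ∈ RegTeam.simplex (U j),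
        (IsMaxOn (RegTeam.brObjective A Om g j yj) (RegTeam.simplex (U j)) d ↔
          d = RegTeam.bestResp A Om g j yj)) ∧
    ∃ gs : RegTeam.Profile Y U,
      -- `gs` is the unique fixed point
      RegTeam.IsPolicy gs ∧ RegTeam.bestResp A Om gs = gs ∧
      (∀ h : RegTeam.Profile Y U, RegTeam.IsPolicy h → RegTeam.bestResp A Om h = h → h = gs) ∧
      -- the synchronous iterates converge to it
      (∀ g : ℕ → RegTeam.Profile Y U, RegTeam.IsPolicy (g 0) →
        (∀ k, g (k + 1) = RegTeam.bestResp A Om (g k)) →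
        Tendsto (fun k => RegTeam.normVec A.ref (g k - gs)) atTop (𝓝 0)) ∧
      -- it is the optimal regularized team decision rule
      RegTeam.IsOptimal A Om gs ∧
      (∀ h : RegTeam.Profile Y U, RegTeam.IsOptimal A Om h →
        ∀ i, h i =ᵐ[A.ref i] gs i) ∧
      -- the asynchronous algorithm converges to it
      (∀ (s : ℕ → Fin N → RegTeam.Activity N) (mem : ℕ → Fin N → RegTeam.Profile Y U),
        RegTeam.FairSchedule s → RegTeam.IsAsyncRun (RegTeam.bestResp A Om) s mem →
        Tendsto (fun t => RegTeam.normVec A.ref ((fun j => mem t j j) - gs))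
          atTop (𝓝 0)) := by
  have H : RegTeam.RegularTeam A Om rho := ⟨hJ, hrho, hOm, hlsc, hP.1⟩
  have hnn : ∀ j i, 0 ≤ RegTeam.gainMatrix A rho j i := fun j i => by
    have := (hrho j).le
    simp only [RegTeam.gainMatrix, Matrix.of_apply]
    split_ifs <;> positivity
  obtain ⟨v, θ, hv, hθ, hθ1, hPv⟩ := RegTeam.exists_weights hnn hP.2
  obtain ⟨gs, hgs, hfix⟩ := H.exists_fixedPoint hv hθ hθ1 hPv
  exact ⟨fun g hg => H.integrable_regReward hg,
    fun g hg => ⟨H.isPolicy_bestResp hg, fun j yj d hd => H.isMaxOn_brObjective_iff hg j yj hd⟩,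
    gs, hgs, hfix, fun h hh hhfix => H.eq_of_fixed hv hθ hθ1 hPv hgs hfix hh hhfix,
    fun g h0 hg => H.tendsto_iterate hv hθ hθ1 hPv hgs hfix h0 hg,
    H.isOptimal_of_fixed hv hθ hθ1 hPv hgs hfix,
    fun h hh => H.ae_eq_of_isOptimal hv hθ hθ1 hPv hgs hfix hh,
    fun s mem hs hrun => H.tendsto_async hv hθ hθ1 hPv hgs hfix hs hrun⟩
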